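/- Let $a,b>0$. There exist $\lambda_0>0$ and $C>0$, depending only on $a$ and $b$, such that the following holds for every $\lambda\in(0,\lambda_0]$ and every $\rho>0$. (i) Let $T>0$ and let $\alpha\in C^2[0,T]$ satisfy $\alpha(0)=1$, $\alpha'\ge 0$ on $[0,T]$ and $\sup_{[0,T]}\alpha'<1$. Put $\Omega_t=(0,\alpha(t))$ and $\widehat Q_T=\{(x,t): 0<t<T,\ x\in\Omega_t\}$. Let $\beta:[0,T]\to[0,\infty)$ be Lipschitz continuous (i.e. $\beta'\in L^\infty(0,T)$) with $$\lambda(\rho+1)\,\beta(t)\ \ge\ \beta'(t)\qquad\text{for a.e. } t\in(0,T).$$ Let $u_0,u_1\in L^2(0,1)$ and let $u$ be a strong solution of $$u_{tt}-u_{xx}+a u_t+b u+\beta(t)|u|^\rho u=0 \ \text{ a.e. in } \widehat Q_T,\qquad u=0 \text{ on the lateral boundary},\qquad u(0)=u_0,\ u_t(0)=u_1,$$ that is, a solution with $u\in L^\infty(0,T;H^1_0(\Omega_t)\cap H^2(\Omega_t))$, $u_t\in L^\infty(0,T;H^1(\Omega_t))$, $u_{tt}\in L^\infty(0,T;L^2(\Omega_t))$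 (weak derivatives; the boundary condition is the membership in $H^1_0(\Omega_t)$, and the initial values are taken as limits in $L^2(0,1)$). Then $u,u_x,u_t$ have representatives that are continuous on $\{(x,t): 0\le t\le T,\ 0\le x\le\alpha(t)\}$; at $t=0$ those of $u$ and $u_t$ equal $u_0$ and $u_1$ a.e. on $(0,1)$; and, computed with these representatives, the energy $$\mathscr E(t)=\int_{\Omega_t}\Big[\tfrac12u_t^2+\tfrac12u_x^2+\tfrac12u^2+\tfrac{\beta(t)}{\rho+2}|u|^{\rho+2}\Big]\,dx$$ satisfies $$\mathscr E(t)\le C\,\mathscr E(0)\,e^{-\lambda t}\qquad\text{for all } t\in[0,T].$$ (ii) The condition allows $\beta$ to grow: for every $T>0$ it holds on $[0,T]$ for $\beta(t)=e^{\mu t}$ with any real $\mu\le\lambda(\rho+1)$; and for every $n\in\mathbb N$ there is a polynomial $\beta(t)=a_nt^n+\dots+a_1t+a_0$ with all $a_i>0$ that satisfies it on $[0,T]$ for every $T>0$. -/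

import Mathlib

open MeasureTheory Set Filter Topology
open scoped NNReal ENNReal ContDiff

/-- Assumption on the moving boundary `x = α(t)`: `α ∈ C²[0,T]`, `α(0) = 1`, `α' ≥ 0` (the domain
expands) and `sup α' < 1` (the domain is time-like). -/
structure IsMovingBoundary (T : ℝ) (α : ℝ → ℝ) : Prop where
  contDiffOn : ContDiffOn ℝ 2 α (Icc 0 T)
  zero : α 0 = 1
  deriv_nonneg : ∀ t ∈ Icc 0 T, 0 ≤ derivWithin α (Icc 0 T) t
  deriv_le : ∃ k < 1, ∀ t ∈ Icc 0 T, derivWithin α (Icc 0 T) t ≤ k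

/-- The non-cylindrical domain `{(x, t) : 0 < t < T, x ∈ Ω_t}` with `Ω_t = (0, α(t))`. Points are
written `(x, t)`, space first. -/
def movingDomain (T : ℝ) (α : ℝ → ℝ) : Set (ℝ × ℝ) :=
  {p | p.2 ∈ Ioo 0 T ∧ p.1 ∈ Ioo 0 (α p.2)}

/-- The closed non-cylindrical domain `{(x, t) : 0 ≤ t ≤ T, 0 ≤ x ≤ α(t)}`. -/
def closedMovingDomain (T : ℝ) (α : ℝ → ℝ) : Set (ℝ × ℝ) :=
  {p | p.2 ∈ Icc 0 T ∧ p.1 ∈ Icc 0 (α p.2)}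

/-- `g` is the weak (distributional) derivative of `f` on the open set `U` in the direction `e`. -/
structure HasWeakDeriv (U : Set (ℝ × ℝ)) (e : ℝ × ℝ) (f g : ℝ × ℝ → ℝ) : Prop where
  locallyIntegrableOn : LocallyIntegrableOn f U
  locallyIntegrableOn_deriv : LocallyIntegrableOn g U
  integral_eq : ∀ φ : ℝ × ℝ → ℝ, ContDiff ℝ ∞ φ → HasCompactSupport φ → tsupport φ ⊆ U →
    ∫ p in U, f p * fderiv ℝ φ p e = - ∫ p in U, g p * φ p

/-- `f ∈ L^∞(0, T; L²(Ω_t))`: `f` is measurable on the non-cylindrical domain and the `L²(Ω_t)`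
norms of its time slices are essentially bounded. -/
structure MemLinftyL2 (T : ℝ) (α : ℝ → ℝ) (f : ℝ × ℝ → ℝ) : Prop where
  aestronglyMeasurable : AEStronglyMeasurable f (volume.restrict (movingDomain T α))
  bound : ∃ M : ℝ≥0, ∀ᵐ t ∂(volume.restrict (Ioo 0 T)),
    eLpNorm (fun x => f (x, t)) 2 (volume.restrict (Ioo 0 (α t))) ≤ M

/-- `f ∈ H¹₀(I)` for an open interval `I`: `f` belongs to the closure of `C_c^∞(I)` in `H¹(I)`
(the `L²`-limit `g` of the derivatives is then the weak derivative of `f`). -/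
def MemH10 (I : Set ℝ) (f : ℝ → ℝ) : Prop :=
  MemLp f 2 (volume.restrict I) ∧
  ∃ g : ℝ → ℝ, MemLp g 2 (volume.restrict I) ∧
  ∃ φ : ℕ → ℝ → ℝ,
    (∀ n, ContDiff ℝ ∞ (φ n) ∧ HasCompactSupport (φ n) ∧ tsupport (φ n) ⊆ I) ∧
    Tendsto (fun n => eLpNorm (fun x => f x - φ n x) 2 (volume.restrict I)) atTop (𝓝 0) ∧
    Tendsto (fun n => eLpNorm (fun x => g x - deriv (φ n) x) 2 (volume.restrict I)) atTop (𝓝 0)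

/-- `f(·, t) → g` in `L²(0, 1)` as `t → 0⁺`. As `f` is only given almost everywhere, the limit
ignores null sets of times. -/
def HasInitialValue (T : ℝ) (f : ℝ × ℝ → ℝ) (g : ℝ → ℝ) : Prop :=
  MemLp g 2 (volume.restrict (Ioo 0 1)) ∧
  Tendsto (fun t => eLpNorm (fun x => f (x, t) - g x) 2 (volume.restrict (Ioo 0 1)))
    (𝓝 0 ⊓ ae (volume.restrict (Ioo 0 T))) (𝓝 0)

/-- `u` is a strong solution of
`u'' - u_xx + a u' + b u + β(t) |u|^ρ u = 0` in the non-cylindrical domain, `u = 0` on the lateral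
boundary, `u(0) = u₀`, `u'(0) = u₁`, in the regularity class
`u ∈ L^∞(0,T; H¹₀(Ω_t) ∩ H²(Ω_t))`, `u_t ∈ L^∞(0,T; H¹(Ω_t))`, `u_tt ∈ L^∞(0,T; L²(Ω_t))`.
All derivatives are weak ones; no continuity is assumed. -/
structure IsStrongSolution (a b ρ T : ℝ) (α β : ℝ → ℝ) (u₀ u₁ : ℝ → ℝ)
    (u ux ut uxx utx utt : ℝ × ℝ → ℝ) : Prop where
  weak_ux : HasWeakDeriv (movingDomain T α) (1, 0) u ux
  weak_ut : HasWeakDeriv (movingDomain T α) (0, 1) u ut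
  weak_uxx : HasWeakDeriv (movingDomain T α) (1, 0) ux uxx
  weak_utx : HasWeakDeriv (movingDomain T α) (1, 0) ut utx
  weak_utt : HasWeakDeriv (movingDomain T α) (0, 1) ut utt
  mem_u : MemLinftyL2 T α u
  mem_ux : MemLinftyL2 T α ux
  mem_uxx : MemLinftyL2 T α uxx
  mem_ut : MemLinftyL2 T α ut
  mem_utx : MemLinftyL2 T α utx
  mem_utt : MemLinftyL2 T α utt
  boundary : ∀ᵐ t ∂(volume.restrict (Ioo 0 T)), MemH10 (Ioo 0 (α t)) (fun x => u (x, t))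
  equation : ∀ᵐ p ∂(volume.restrict (movingDomain T α)),
    utt p - uxx p + a * ut p + b * u p + β p.2 * (|u p| ^ ρ * u p) = 0
  initial : HasInitialValue T u u₀
  initial_deriv : HasInitialValue T ut u₁

/-- `v` is the continuous representative of `f`, up to the boundary of the non-cylindrical
domain. -/
def IsContinuousRepresentative (T : ℝ) (α : ℝ → ℝ) (f v : ℝ × ℝ → ℝ) : Prop :=
  ContinuousOn v (closedMovingDomain T α) ∧ v =ᵐ[volume.restrict (movingDomain T α)] f

/-- The energy
`∫_{Ω_t} [½ u_t² + ½ u_x² + ½ u² + β(t)/(ρ+2) |u|^{ρ+2}] dx`. -/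
noncomputable def energy (ρ : ℝ) (α β : ℝ → ℝ) (u ux ut : ℝ × ℝ → ℝ) (t : ℝ) : ℝ :=
  ∫ x in (0 : ℝ)..α t, (1 / 2 * ut (x, t) ^ 2 + 1 / 2 * ux (x, t) ^ 2 + 1 / 2 * u (x, t) ^ 2
    + β t * (1 / (ρ + 2)) * |u (x, t)| ^ (ρ + 2))

/-- The coefficient condition on `[0, T]`: `β ≥ 0`, `β' ∈ L^∞(0, T)` (that is, `β` is Lipschitz), and
`lam (ρ + 1) β ≥ β'` almost everywhere. -/
structure IsAdmissibleCoefficient (lam ρ T : ℝ) (β : ℝ → ℝ) : Prop where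
  lipschitz : ∃ K : ℝ≥0, LipschitzOnWith K β (Icc 0 T)
  nonneg : ∀ t ∈ Icc 0 T, 0 ≤ β t
  growth : ∀ᵐ t ∂(volume.restrict (Ioo 0 T)), deriv β t ≤ lam * (ρ + 1) * β t

/-! The decay comes from the multiplier `u_t + ε u`. It leads to the energy with density `D = ½u_t²
+ ½u_x² + (b + εa)/2 u² + ε u u_t + β Φ(u)`, where `Φ(y) = |y|^(ρ+2)/(ρ+2)`, and to the flux `q =
u_x u_t + ε u u_x`. The weight `(b + εa)/2` cancels all products `u u_t`, so the equation gives `D_t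
- q_x = -(a-ε)u_t² - ε u_x² - εb u² - ε(ρ+2)βΦ + β'Φ`. The growth condition bounds `β'Φ + λβΦ` by
`λ(ρ+2)βΦ`, which `λ ≤ ε` absorbs whatever `ρ` is; the quadratic terms need only `ε` and `λ` small
in terms of `a` and `b`. Hence `D_t ≤ q_x - λD` (`IsDecayRate.dissipation`), while `D` is comparable
to the energy density (`IsDecayRate.lower`, `IsDecayRate.upper`).

At `x = 0` the flux vanishes. On `x = α(t)` the vanishing of `u` gives `u_t = -α' u_x`, so flux plus
transport contribute `-½ α'(1 - α'²) u_x² ≤ 0`. The domain grows, so rectangles standing on a time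
slice stay inside it: `rectangle_inequality` integrates `D_t ≤ q_x - λD` there, the strip swept by
the boundary is added to first order (`hasDerivWithinAt_integral_swept`), and a Gronwall argument
with one-sided difference quotients concludes (`modified_energy_le`).

The rest gives meaning to these computations for weak derivatives. A weak derivative is integrated
along translations (`HasWeakDeriv.ae_sub_eq_integral`), so on almost every line the function is a
primitive. Square integrability in space makes almost every slice Hölder of exponent 1/2, and an
averaging argument compares slices at different times; thus `u`, `u_x` and `u_t` extend continuously
to the closed domain (`exists_continuous_representative`). Second derivatives remain integrable
functions, and calculus is done through `IsPrimitive` on almost every line. -/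

/-! ### Weak derivatives and translations -/

/-- A product of two translated functions is integrable for the product measure. -/
lemma integrable_translate_mul {f φ : ℝ × ℝ → ℝ} {e : ℝ × ℝ} (hf : Integrable f)
    (hφ : Continuous φ) (hφc : HasCompactSupport φ) (μ : Measure ℝ) [IsFiniteMeasure μ] :
    Integrable (fun z : ℝ × (ℝ × ℝ) => f (z.2 + z.1 • e) * φ z.2) (μ.prod volume) := by
  obtain ⟨C, hC⟩ := hφ.bounded_above_of_compact_support hφc
  have hmp : MeasurePreserving (fun z : ℝ × (ℝ × ℝ) => (z.1, z.2 + z.1 • e))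
      (μ.prod volume) (μ.prod volume) := by
    refine (MeasurePreserving.id μ).skew_product (g := fun σ p => p + σ • e) ?_ ?_
    · exact Continuous.measurable (by fun_prop)
    · exact Eventually.of_forall fun σ => (measurePreserving_add_right volume (σ • e)).map_eq
  have h1 : Integrable (fun z : ℝ × (ℝ × ℝ) => f z.2) (μ.prod volume) := hf.comp_snd μ
  have h2 := hmp.integrable_comp_of_integrable h1
  exact h2.mul_bdd (c := C) (Continuous.aestronglyMeasurable (by fun_prop))
    (Eventually.of_forall fun z => hC _)

lemma integral_mul_translate (f φ : ℝ × ℝ → ℝ) (w : ℝ × ℝ) :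
    ∫ p, f p * φ (p - w) = ∫ p, f (p + w) * φ p := by
  rw [← integral_add_right_eq_self (fun p => f p * φ (p - w)) w]
  simp

/-- The derivative of the translation of a pairing with a test function. -/
lemma hasDerivAt_integral_mul_translate {f φ : ℝ × ℝ → ℝ} (hf : Integrable f)
    (hφ : ContDiff ℝ ∞ φ) (hφc : HasCompactSupport φ) (e : ℝ × ℝ) (σ : ℝ) :
    HasDerivAt (fun σ : ℝ => ∫ p, f p * φ (p - σ • e))
      (∫ p, f p * -(fderiv ℝ φ (p - σ • e) e)) σ := by
  have hd : Continuous (fun p => fderiv ℝ φ p e) :=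
    (hφ.continuous_fderiv (by simp)).clm_apply continuous_const
  have hdc : HasCompactSupport (fun p => fderiv ℝ φ p e) := hφc.fderiv_apply ℝ e
  obtain ⟨C, hC⟩ := hφ.continuous.bounded_above_of_compact_support hφc
  obtain ⟨D, hD⟩ := hd.bounded_above_of_compact_support hdc
  refine (hasDerivAt_integral_of_dominated_loc_of_deriv_le (s := univ)
    (bound := fun p => ‖f p‖ * D) (F := fun (σ : ℝ) p => f p * φ (p - σ • e))
    (F' := fun (σ : ℝ) p => f p * -(fderiv ℝ φ (p - σ • e) e)) univ_mem ?_ ?_ ?_ ?_ ?_ ?_).2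
  · refine Eventually.of_forall fun τ => hf.aestronglyMeasurable.mul ?_
    exact (hφ.continuous.comp (by fun_prop)).aestronglyMeasurable
  · refine hf.mul_bdd (c := C) ?_ (Eventually.of_forall fun p => hC _)
    exact (hφ.continuous.comp (by fun_prop)).aestronglyMeasurable
  · refine hf.aestronglyMeasurable.mul ?_
    exact (hd.comp (f := fun p : ℝ × ℝ => p - σ • e) (by fun_prop)).neg.aestronglyMeasurable
  · refine Eventually.of_forall fun p τ _ => ?_
    rw [norm_mul, norm_neg]
    exact mul_le_mul_of_nonneg_left (hD _) (norm_nonneg _)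
  · exact hf.norm.mul_const D
  · refine Eventually.of_forall fun p τ _ => ?_
    have h1 : HasDerivAt (fun τ : ℝ => p - τ • e) (-e) τ := by
      simpa using ((hasDerivAt_id τ).smul_const e).const_sub p
    have h2 := ((hφ.differentiable (by simp)).differentiableAt
      (x := p - τ • e)).hasFDerivAt.comp_hasDerivAt τ h1
    simpa using h2.const_mul (f p)

/-- A weakly differentiable function is recovered, along translations, from its weak derivative. -/
theorem HasWeakDeriv.ae_sub_eq_integral {U V : Set (ℝ × ℝ)} {e : ℝ × ℝ} {f g : ℝ × ℝ → ℝ}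
    (h : HasWeakDeriv U e f g) (hf : Integrable f) (hg : Integrable g) (hV : IsOpen V) {k : ℝ}
    (hVU : ∀ z ∈ V, ∀ σ ∈ uIcc 0 k, z + σ • e ∈ U) :
    ∀ᵐ z, z ∈ V → f (z + k • e) - f z - ∫ σ in (0 : ℝ)..k, g (z + σ • e) = 0 := by
  have : IsFiniteMeasure (volume.restrict (uIoc 0 k)) := ⟨by simp [uIoc]⟩
  have hint : Integrable (fun z : ℝ × ℝ => ∫ σ in uIoc 0 k, g (z + σ • e)) := by
    have hmp : MeasurePreserving (fun z : ℝ × (ℝ × ℝ) => (z.1, z.2 + z.1 • e))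
        ((volume.restrict (uIoc 0 k)).prod volume)
        ((volume.restrict (uIoc 0 k)).prod volume) := by
      refine (MeasurePreserving.id _).skew_product (g := fun σ p => p + σ • e) ?_ ?_
      · exact Continuous.measurable (by fun_prop)
      · exact Eventually.of_forall fun σ => (measurePreserving_add_right volume (σ • e)).map_eq
    have h1 : Integrable (fun z : ℝ × (ℝ × ℝ) => g z.2)
      ((volume.restrict (uIoc 0 k)).prod volume) := hg.comp_snd _
    exact (hmp.integrable_comp_of_integrable h1).integral_prod_right
  have hint' : Integrable (fun z : ℝ × ℝ => ∫ σ in (0 : ℝ)..k, g (z + σ • e)) := by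
    simp_rw [intervalIntegral.intervalIntegral_eq_integral_uIoc]
    exact hint.smul (if 0 ≤ k then (1 : ℝ) else -1)
  have hfk : Integrable (fun z => f (z + k • e)) := hf.comp_add_right _
  -- Testing against `φ` supported in `V` suffices. Shifting the translation onto `φ` makes the
  -- pairing with `f` a differentiable function of the shift, whose derivative is the pairing with
  -- `g`.
  refine hV.ae_eq_zero_of_integral_contDiff_smul_eq_zero
    (((hfk.sub hf).sub hint').locallyIntegrable.locallyIntegrableOn V) fun φ hφ hφc hφV => ?_
  obtain ⟨C, hC⟩ := hφ.continuous.bounded_above_of_compact_support hφc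
  have hbd : ∀ {F : ℝ × ℝ → ℝ}, Integrable F → Integrable fun p => φ p * F p := fun hF =>
    hF.bdd_mul (c := C) hφ.continuous.aestronglyMeasurable (Eventually.of_forall hC)
  have hcont : ∀ {F ψ : ℝ × ℝ → ℝ}, Integrable F → Continuous ψ → HasCompactSupport ψ →
      Continuous fun σ : ℝ => ∫ p, F p * ψ (p - σ • e) := by
    intro F ψ hF hψ hψc
    obtain ⟨D, hD⟩ := hψ.bounded_above_of_compact_support hψc
    refine continuous_of_dominated (bound := fun p => ‖F p‖ * D) ?_ ?_ ?_ ?_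
    · exact fun σ => hF.aestronglyMeasurable.mul
        (hψ.comp (f := fun p : ℝ × ℝ => p - σ • e) (by fun_prop)).aestronglyMeasurable
    · refine fun σ => Eventually.of_forall fun p => ?_
      rw [norm_mul]
      exact mul_le_mul_of_nonneg_left (hD _) (norm_nonneg _)
    · exact hF.norm.mul_const D
    · exact Eventually.of_forall fun p => continuous_const.mul (hψ.comp (by fun_prop))
  have hderiv : ∀ σ ∈ uIcc 0 k, HasDerivAt (fun σ : ℝ => ∫ p, f p * φ (p - σ • e))
      (∫ p, g p * φ (p - σ • e)) σ := by
    intro σ hσ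
    convert hasDerivAt_integral_mul_translate hf hφ hφc e σ using 1
    have hs : ContDiff ℝ ∞ (fun p : ℝ × ℝ => φ (p - σ • e)) := hφ.comp (by fun_prop)
    have hsc : HasCompactSupport (fun p : ℝ × ℝ => φ (p - σ • e)) := by
      simpa [sub_eq_add_neg, Function.comp_def] using
        hφc.comp_homeomorph (Homeomorph.addRight (-(σ • e)))
    -- The hypothesis on `V` enters here: every shift of `φ` between `0` and `k` is still a test
    -- function on `U`.
    have hts : tsupport (fun p : ℝ × ℝ => φ (p - σ • e)) ⊆ U := by
      have := tsupport_comp_subset_preimage φ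
        (f := fun p : ℝ × ℝ => p - σ • e) (by fun_prop)
      intro p hp
      have h1 := hVU _ (hφV (this hp)) σ hσ
      simpa using h1
    have hw := h.integral_eq _ hs hsc hts
    have hfd : ∀ p, fderiv ℝ (fun p : ℝ × ℝ => φ (p - σ • e)) p = fderiv ℝ φ (p - σ • e) :=
      fun p => by rw [fderiv_comp_sub]
    rw [setIntegral_eq_integral_of_forall_compl_eq_zero,
      setIntegral_eq_integral_of_forall_compl_eq_zero] at hw
    · simp_rw [hfd] at hw
      simp_rw [mul_neg, integral_neg]
      linarith
    · intro p hp
      have : p ∉ tsupport (fun p : ℝ × ℝ => φ (p - σ • e)) := fun h => hp (hts h)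
      simp [image_eq_zero_of_notMem_tsupport this]
    · intro p hp
      have : p ∉ tsupport (fderiv ℝ (fun p : ℝ × ℝ => φ (p - σ • e))) :=
        fun h => hp (hts (tsupport_fderiv_subset ℝ h))
      simp [image_eq_zero_of_notMem_tsupport this]
  have hftc := intervalIntegral.integral_eq_sub_of_hasDerivAt hderiv
    ((hcont hg hφ.continuous hφc).intervalIntegrable _ _)
  simp only [zero_smul, sub_zero] at hftc
  have hfub : ∫ σ in (0 : ℝ)..k, ∫ p, g p * φ (p - σ • e)
      = ∫ p, φ p * ∫ σ in (0 : ℝ)..k, g (p + σ • e) := by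
    simp_rw [intervalIntegral.intervalIntegral_eq_integral_uIoc, integral_mul_translate,
      smul_eq_mul, mul_left_comm (φ _), integral_const_mul]
    congr 1
    rw [integral_integral_swap (integrable_translate_mul hg hφ.continuous hφc _)]
    congr 1 with p
    rw [integral_mul_const, mul_comm]
  rw [hfub, integral_mul_translate] at hftc
  simp only [smul_eq_mul, mul_sub]
  have h1 : Integrable fun p => φ p * f (p + k • e) - φ p * f p := (hbd hfk).sub (hbd hf)
  rw [integral_sub h1 (hbd hint'), integral_sub (hbd hfk) (hbd hf), hftc]
  simp_rw [mul_comm (φ _)]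
  ring

/-- A test function supported in `V` kills both integrands off `V`, so the integrals over `V`, over
`U` and over the plane agree. -/
lemma HasWeakDeriv.mono {U V : Set (ℝ × ℝ)} {e : ℝ × ℝ} {f g : ℝ × ℝ → ℝ}
    (h : HasWeakDeriv U e f g) (hVU : V ⊆ U) : HasWeakDeriv V e f g where
  locallyIntegrableOn := h.locallyIntegrableOn.mono_set hVU
  locallyIntegrableOn_deriv := h.locallyIntegrableOn_deriv.mono_set hVU
  integral_eq φ hφ hφc hφV := by
    have hw := h.integral_eq φ hφ hφc (hφV.trans hVU)
    have h1 : ∀ p, p ∉ V → f p * fderiv ℝ φ p e = 0 := fun p hp => by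
      have : p ∉ tsupport (fderiv ℝ φ) := fun h => hp (hφV (tsupport_fderiv_subset ℝ h))
      simp [image_eq_zero_of_notMem_tsupport this]
    have h2 : ∀ p, p ∉ V → g p * φ p = 0 := fun p hp => by
      simp [image_eq_zero_of_notMem_tsupport fun h => hp (hφV h)]
    rw [setIntegral_eq_integral_of_forall_compl_eq_zero h1,
      setIntegral_eq_integral_of_forall_compl_eq_zero h2]
    rwa [setIntegral_eq_integral_of_forall_compl_eq_zero fun p hp => h1 p fun h => hp (hVU h),
      setIntegral_eq_integral_of_forall_compl_eq_zero fun p hp => h2 p fun h => hp (hVU h)] at hw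

lemma HasWeakDeriv.congr {U : Set (ℝ × ℝ)} {e : ℝ × ℝ} {f g f' g' : ℝ × ℝ → ℝ}
    (h : HasWeakDeriv U e f g) (hf : f =ᵐ[volume.restrict U] f')
    (hg : g =ᵐ[volume.restrict U] g') (hf' : LocallyIntegrableOn f' U)
    (hg' : LocallyIntegrableOn g' U) : HasWeakDeriv U e f' g' where
  locallyIntegrableOn := hf'
  locallyIntegrableOn_deriv := hg'
  integral_eq φ hφ hφc hφV := by
    rw [integral_congr_ae (g := fun p => f p * fderiv ℝ φ p e),
      integral_congr_ae (f := fun p => g' p * φ p) (g := fun p => g p * φ p)]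
    · exact h.integral_eq φ hφ hφc hφV
    · filter_upwards [hg] with p hp using by rw [hp]
    · filter_upwards [hf] with p hp using by rw [hp]

lemma measurePreserving_swap_real :
    MeasurePreserving (Prod.swap : ℝ × ℝ → ℝ × ℝ) volume volume :=
  Measure.measurePreserving_swap

/-- Exchanging the two variables in a weak derivative. -/
lemma HasWeakDeriv.swap {U : Set (ℝ × ℝ)} {e : ℝ × ℝ} {f g : ℝ × ℝ → ℝ}
    (h : HasWeakDeriv U e f g) (hf : Integrable f) (hg : Integrable g) :
    HasWeakDeriv (Prod.swap ⁻¹' U) e.swap (f ∘ Prod.swap) (g ∘ Prod.swap) where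
  locallyIntegrableOn :=
    (measurePreserving_swap_real.integrable_comp_of_integrable
      hf).locallyIntegrable.locallyIntegrableOn _
  locallyIntegrableOn_deriv :=
    (measurePreserving_swap_real.integrable_comp_of_integrable
      hg).locallyIntegrable.locallyIntegrableOn _
  integral_eq φ hφ hφc hφV := by
    have hemb : MeasurableEmbedding (Prod.swap : ℝ × ℝ → ℝ × ℝ) :=
      (MeasurableEquiv.prodComm (α := ℝ) (β := ℝ)).measurableEmbedding
    have hsm : ContDiff ℝ ∞ (Prod.swap : ℝ × ℝ → ℝ × ℝ) := contDiff_snd.prodMk contDiff_fst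
    have hw := h.integral_eq (φ ∘ Prod.swap) (hφ.comp hsm)
      (hφc.comp_homeomorph (Homeomorph.prodComm ℝ ℝ)) ?_
    · rw [← measurePreserving_swap_real.setIntegral_preimage_emb hemb
          (fun p => f p * fderiv ℝ (φ ∘ Prod.swap) p e) U,
        ← measurePreserving_swap_real.setIntegral_preimage_emb hemb
          (fun p => g p * (φ ∘ Prod.swap) p) U] at hw
      simp only [Function.comp_apply, Prod.swap_swap] at hw ⊢
      rw [← hw]
      congr 1 with p
      congr 1
      · have h2 : HasFDerivAt (Prod.swap : ℝ × ℝ → ℝ × ℝ)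
            ((ContinuousLinearMap.snd ℝ ℝ ℝ).prod (ContinuousLinearMap.fst ℝ ℝ ℝ)) p.swap :=
          hasFDerivAt_snd.prodMk hasFDerivAt_fst
        have h1 := ((hφ.differentiable (by simp)).differentiableAt
          (x := p.swap.swap)).hasFDerivAt.comp p.swap h2
        rw [h1.fderiv]
        simp [Prod.swap]
    · have := tsupport_comp_subset_preimage φ (f := (Prod.swap : ℝ × ℝ → ℝ × ℝ)) continuous_swap
      intro p hp
      simpa using hφV (this hp)

/-- A weakly differentiable function is almost everywhere a primitive of its weak derivative along
the lines parallel to the first axis. -/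
theorem HasWeakDeriv.ae_eq_add_integral_fst {U : Set (ℝ × ℝ)} {f g : ℝ × ℝ → ℝ}
    (h : HasWeakDeriv U (1, 0) f g) (hf : Integrable f) (hg : Integrable g)
    (hfm : Measurable f) (hgm : Measurable g) (hU : IsOpen U)
    (hconn : ∀ x y w t : ℝ, (x, t) ∈ U → (y, t) ∈ U → w ∈ uIcc x y → (w, t) ∈ U)
    {p q : ℝ} (hpq : p < q) (hbase : ∀ z ∈ U, ∀ y ∈ Ioo p q, (y, z.2) ∈ U) :
    ∃ c : ℝ → ℝ, ∀ᵐ z : ℝ × ℝ, z ∈ U → f z = c z.2 + ∫ w in Iic z.1, g (w, z.2) := by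
  set H : ℝ × ℝ → ℝ := fun z => ∫ w in Iic z.1, g (w, z.2) with hH
  have hHm : Measurable H := by
    have h1 : StronglyMeasurable fun z : (ℝ × ℝ) × ℝ =>
        ({z : (ℝ × ℝ) × ℝ | z.2 ≤ z.1.1}.indicator (fun z => g (z.2, z.1.2))) z := by
      refine StronglyMeasurable.indicator ?_ ?_
      · exact (hgm.comp (by fun_prop)).stronglyMeasurable
      · exact measurableSet_le (by fun_prop) (by fun_prop)
    have h2 := h1.integral_prod_right' (ν := (volume : Measure ℝ))
    convert h2.measurable using 1
    ext z
    exact (integral_indicator (f := fun w => g (w, z.2)) measurableSet_Iic).symm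
  set K : ℝ × ℝ → ℝ := fun z => f z - H z with hK
  have hKm : Measurable K := hfm.sub hHm
  have hgood : ∀ᵐ z : ℝ × ℝ, Integrable fun w => g (w, z.2) :=
    Measure.quasiMeasurePreserving_snd.ae hg.prod_left_ae
  -- `K` is `f` minus a primitive of `g`, so the translation identity says that `K` is invariant
  -- under each horizontal shift, off a null set depending on the shift.
  have h1 : ∀ k : ℝ, ∀ᵐ z : ℝ × ℝ, z ∈ U → (z.1 + k, z.2) ∈ U → K (z.1 + k, z.2) = K z := by
    intro k
    have hV : IsOpen {z : ℝ × ℝ | z ∈ U ∧ (z.1 + k, z.2) ∈ U} :=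
      hU.inter (hU.preimage (by fun_prop))
    have hw := h.ae_sub_eq_integral hf hg hV (k := k) (fun z hz σ hσ => by
      have := hconn z.1 (z.1 + k) (z.1 + σ) z.2 hz.1 hz.2 (by
        rw [mem_uIcc] at hσ ⊢
        rcases hσ with hσ | hσ
        · left; constructor <;> linarith
        · right; constructor <;> linarith)
      convert this using 1
      ext <;> simp)
    filter_upwards [hw, hgood] with z hz hgz hzU hzk
    have h2 := hz ⟨hzU, hzk⟩
    have h3 : ∫ σ in (0 : ℝ)..k, g (z + σ • ((1 : ℝ), (0 : ℝ))) = H (z.1 + k, z.2) - H z := by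
      have h4 : ∀ σ : ℝ, z + σ • ((1 : ℝ), (0 : ℝ)) = (z.1 + σ, z.2) := fun σ => by
        ext <;> simp
      simp_rw [h4]
      rw [intervalIntegral.integral_comp_add_left (fun w => g (w, z.2)), hH]
      simp only [add_zero]
      rw [intervalIntegral.integral_Iic_sub_Iic hgz.integrableOn hgz.integrableOn]
    have h5 : z + k • ((1 : ℝ), (0 : ℝ)) = (z.1 + k, z.2) := by ext <;> simp
    rw [h3, h5] at h2
    simp only [hK]
    linarith
  -- Fubini exchanges the quantifiers: for almost every `z`, almost every shift is good.
  have h2 : ∀ᵐ z : ℝ × ℝ, ∀ᵐ k : ℝ, z ∈ U → (z.1 + k, z.2) ∈ U → K (z.1 + k, z.2) = K z := by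
    refine (Measure.ae_ae_comm ?_).1 (Eventually.of_forall (f := ae (volume : Measure ℝ)) h1)
    simp only [imp_iff_not_or, ofPred_or]
    refine MeasurableSet.union ?_ (MeasurableSet.union ?_ ?_)
    · exact (hU.preimage continuous_snd).measurableSet.compl
    · exact (hU.preimage (f := fun x : ℝ × (ℝ × ℝ) => (x.2.1 + x.1, x.2.2))
        (by fun_prop)).measurableSet.compl
    · exact measurableSet_eq_fun (hKm.comp (by fun_prop)) (hKm.comp (by fun_prop))
  -- The constant on each line is the mean of `K` over `(p, q)`, a segment common to all lines
  -- meeting `U`.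
  refine ⟨fun t => (q - p)⁻¹ * ∫ y in Ioo p q, K (y, t), ?_⟩
  filter_upwards [h2] with z hz hzU
  have h3 : ∀ᵐ y : ℝ, z ∈ U → (y, z.2) ∈ U → K (y, z.2) = K z := by
    have := (measurePreserving_sub_right (volume : Measure ℝ) z.1).quasiMeasurePreserving.ae hz
    simpa using this
  have h4 : ∫ y in Ioo p q, K (y, z.2) = ∫ y in Ioo p q, K z := by
    refine setIntegral_congr_ae measurableSet_Ioo ?_
    filter_upwards [h3] with y hy hyI using hy hzU (hbase z hzU y hyI)
  rw [h4]
  have : q - p ≠ 0 := by linarith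
  simp only [integral_const, MeasurableSet.univ, measureReal_restrict_apply, univ_inter,
    Real.volume_real_Ioo_of_le hpq.le, smul_eq_mul]
  rw [← mul_assoc, inv_mul_cancel₀ this]
  simp [hK, hH]

/-! ### Continuous representatives -/

lemma ae_ae_fst_of_ae {P : ℝ × ℝ → Prop} (h : ∀ᵐ z, P z) : ∀ᵐ t : ℝ, ∀ᵐ x : ℝ, P (x, t) :=
  Measure.ae_ae_of_ae_prod (measurePreserving_swap_real.quasiMeasurePreserving.ae h)

lemma ae_ae_snd_of_ae {P : ℝ × ℝ → Prop} (h : ∀ᵐ z, P z) : ∀ᵐ x : ℝ, ∀ᵐ t : ℝ, P (x, t) :=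
  Measure.ae_ae_of_ae_prod h

lemma ae_of_ae_ae_fst {P : ℝ × ℝ → Prop} (hm : MeasurableSet {z | P z})
    (h : ∀ᵐ t : ℝ, ∀ᵐ x : ℝ, P (x, t)) : ∀ᵐ z, P z :=
  (Measure.ae_prod_iff_ae_ae hm).2 ((Measure.ae_ae_comm (p := fun x t => P (x, t)) hm).2 h)

/-- The `L¹` norms on intervals of the time slices of `f` have Hölder exponent `1/2`, uniformly
in time. -/
def SliceBound (T : ℝ) (γ : ℝ → ℝ) (M : ℝ) (f : ℝ × ℝ → ℝ) : Prop :=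
  ∀ᵐ t : ℝ, t ∈ Ioo 0 T → ∀ a b, 0 ≤ a → a ≤ b → b ≤ γ t →
    ∫⁻ x in Ioo a b, ‖f (x, t)‖ₑ ≤ ENNReal.ofReal (M * √(b - a))

/-- A continuous, nondecreasing lateral boundary that stays to the right of `1`. -/
structure IsExpanding (γ : ℝ → ℝ) : Prop where
  continuous : Continuous γ
  monotone : Monotone γ
  one_le : ∀ t, 1 ≤ γ t

lemma IsExpanding.pos {γ : ℝ → ℝ} (hγ : IsExpanding γ) (t : ℝ) : 0 < γ t :=
  one_pos.trans_le (hγ.one_le t)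

lemma IsExpanding.isOpen {γ : ℝ → ℝ} (hγ : IsExpanding γ) (T : ℝ) : IsOpen (movingDomain T γ) :=
  (isOpen_Ioo.preimage continuous_snd).inter
    ((isOpen_lt continuous_const continuous_fst).inter
      (isOpen_lt continuous_fst (hγ.continuous.comp continuous_snd)))

/-! ### Primitives along lines and moduli of continuity -/

section

variable {T M : ℝ} {γ : ℝ → ℝ} {f fx ft : ℝ × ℝ → ℝ}

/-- Almost every space slice of a weakly differentiable function is a primitive. -/
theorem HasWeakDeriv.ae_slice_fst (hγ : IsExpanding γ)
    (h : HasWeakDeriv (movingDomain T γ) (1, 0) f fx) (hf : Integrable f) (hfx : Integrable fx)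
    (hfm : Measurable f) (hfxm : Measurable fx) :
    ∀ᵐ t : ℝ, t ∈ Ioo 0 T → (Integrable fun x => fx (x, t)) ∧ ∃ c : ℝ, ∀ᵐ x : ℝ,
      x ∈ Ioo 0 (γ t) → f (x, t) = c + ∫ y in (0 : ℝ)..x, fx (y, t) := by
  obtain ⟨c, hc⟩ := h.ae_eq_add_integral_fst hf hfx hfm hfxm (hγ.isOpen T)
    (fun x y w t hx hy hw => ⟨hx.1, by
      rcases mem_uIcc.1 hw with hw | hw
      · exact ⟨hx.2.1.trans_le hw.1, hw.2.trans_lt hy.2.2⟩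
      · exact ⟨hy.2.1.trans_le hw.1, hw.2.trans_lt hx.2.2⟩⟩)
    zero_lt_one (fun z hz y hy => ⟨hz.1, hy.1, hy.2.trans_le (hγ.one_le _)⟩)
  filter_upwards [ae_ae_fst_of_ae hc, hfx.prod_left_ae] with t ht hi htT
  refine ⟨hi, c t + ∫ w in Iic 0, fx (w, t), ?_⟩
  filter_upwards [ht] with x hx hxI
  rw [hx ⟨htT, hxI⟩, ← intervalIntegral.integral_Iic_sub_Iic hi.integrableOn hi.integrableOn]
  ring

/-- On a rectangle, a weakly differentiable function is almost everywhere a primitive in time. -/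
theorem HasWeakDeriv.ae_eq_add_integral_snd (hγ : IsExpanding γ)
    (h : HasWeakDeriv (movingDomain T γ) (0, 1) f ft) (hf : Integrable f) (hft : Integrable ft)
    (hfm : Measurable f) (hftm : Measurable ft) {s : ℝ} (hs : 0 ≤ s) (hsT : s < T) :
    ∃ c : ℝ → ℝ, ∀ᵐ z : ℝ × ℝ, z.1 ∈ Ioo 0 (γ s) → z.2 ∈ Ioo s T →
      f z = c z.1 + ∫ τ in Iic z.2, ft (z.1, τ) := by
  -- Monotonicity of `γ` keeps the rectangle standing on the slice at time `s` inside the domain.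
  have hsub : Ioo 0 (γ s) ×ˢ Ioo s T ⊆ movingDomain T γ := fun z hz =>
    ⟨⟨hs.trans_lt hz.2.1, hz.2.2⟩, hz.1.1, hz.1.2.trans_le (hγ.monotone hz.2.1.le)⟩
  have hw := (h.mono hsub).swap hf hft
  have hopen : IsOpen ((Prod.swap : ℝ × ℝ → ℝ × ℝ) ⁻¹' (Ioo 0 (γ s) ×ˢ Ioo s T)) :=
    (isOpen_Ioo.prod isOpen_Ioo).preimage continuous_swap
  obtain ⟨c, hc⟩ := HasWeakDeriv.ae_eq_add_integral_fst hw
    (measurePreserving_swap_real.integrable_comp_of_integrable hf)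
    (measurePreserving_swap_real.integrable_comp_of_integrable hft)
    (hfm.comp measurable_swap) (hftm.comp measurable_swap) hopen
    (fun x y w t hx hy hw => ⟨hx.1, by
      rcases mem_uIcc.1 hw with hw | hw
      · exact ⟨hx.2.1.trans_le hw.1, hw.2.trans_lt hy.2.2⟩
      · exact ⟨hy.2.1.trans_le hw.1, hw.2.trans_lt hx.2.2⟩⟩)
    hsT (fun z hz y hy => ⟨hz.1, hy⟩)
  refine ⟨c, ?_⟩
  filter_upwards [measurePreserving_swap_real.quasiMeasurePreserving.ae hc] with z hz h1 h2
  exact hz ⟨h1, h2⟩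

/-- Outside a null set of times, the difference of two time slices of a weakly differentiable
function is the integral of its weak time derivative. -/
theorem HasWeakDeriv.ae_slice_snd (hγ : IsExpanding γ)
    (h : HasWeakDeriv (movingDomain T γ) (0, 1) f ft) (hf : Integrable f) (hft : Integrable ft)
    (hfm : Measurable f) (hftm : Measurable ft) :
    ∃ S : Set ℝ, (∀ᵐ t : ℝ, t ∈ S) ∧ ∀ t ∈ S, ∀ t' ∈ S, 0 < t → t ≤ t' → t' < T →
      ∀ᵐ x : ℝ, x ∈ Ioo 0 (γ t) → f (x, t') - f (x, t) = ∫ τ in t..t', ft (x, τ) := by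
  have h1 : ∀ s : ℝ, 0 < s → s < T → ∃ c : ℝ → ℝ, ∀ᵐ t : ℝ, ∀ᵐ x : ℝ,
      x ∈ Ioo 0 (γ s) → t ∈ Ioo s T → f (x, t) = c x + ∫ τ in Iic t, ft (x, τ) := by
    intro s hs hsT
    obtain ⟨c, hc⟩ := h.ae_eq_add_integral_snd hγ hf hft hfm hftm hs.le hsT
    refine ⟨c, ?_⟩
    filter_upwards [ae_ae_fst_of_ae hc] with t ht
    filter_upwards [ht] with x hx hxI htI using hx hxI htI
  choose! c hc using h1
  -- Rational starting times keep the exceptional set null. Given `x < γ t`, continuity of `γ`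
  -- provides a rational `s < t` with `x < γ s`, and `c s x` cancels in the difference.
  refine ⟨{t | ∀ s : ℚ, 0 < (s : ℝ) → (s : ℝ) < T → ∀ᵐ x : ℝ, x ∈ Ioo 0 (γ s) → t ∈ Ioo (s : ℝ) T →
    f (x, t) = c s x + ∫ τ in Iic t, ft (x, τ)}, ?_, ?_⟩
  · simp only [mem_ofPred_eq]
    rw [ae_all_iff]
    intro s
    by_cases hs : 0 < (s : ℝ) ∧ (s : ℝ) < T
    · filter_upwards [hc s hs.1 hs.2] with t ht _ _ using ht
    · exact Eventually.of_forall fun t h1 h2 => (hs ⟨h1, h2⟩).elim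
  · intro t ht t' ht' h0 htt' hT
    have h2 : ∀ᵐ x : ℝ, ∀ s : ℚ, 0 < (s : ℝ) → (s : ℝ) < T →
        (x ∈ Ioo 0 (γ s) → t ∈ Ioo (s : ℝ) T → f (x, t) = c s x + ∫ τ in Iic t, ft (x, τ)) ∧
        (x ∈ Ioo 0 (γ s) → t' ∈ Ioo (s : ℝ) T → f (x, t') = c s x + ∫ τ in Iic t', ft (x, τ)) := by
      rw [ae_all_iff]
      intro s
      by_cases hs : 0 < (s : ℝ) ∧ (s : ℝ) < T
      · filter_upwards [ht s hs.1 hs.2, ht' s hs.1 hs.2] with x h1 h2 _ _ using ⟨h1, h2⟩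
      · exact Eventually.of_forall fun t h1 h2 => (hs ⟨h1, h2⟩).elim
    filter_upwards [h2, hft.prod_right_ae] with x hx hi hxI
    have h3 : ∀ᶠ s in 𝓝[<] t, 0 < s ∧ x < γ s := by
      refine nhdsWithin_le_nhds ?_
      exact (lt_mem_nhds h0).and
        (hγ.continuous.continuousAt.eventually (lt_mem_nhds hxI.2))
    obtain ⟨l, hl, hl'⟩ := (mem_nhdsLT_iff_exists_Ioo_subset).1 h3
    obtain ⟨s, hs1, hs2⟩ := exists_rat_btwn (show l < t from hl)
    have h4 := hl' ⟨hs1, hs2⟩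
    have h5 := hx s h4.1 (by linarith)
    rw [h5.1 ⟨hxI.1, h4.2⟩ ⟨hs2, by linarith⟩, h5.2 ⟨hxI.1, h4.2⟩ ⟨by linarith, hT⟩,
      ← intervalIntegral.integral_Iic_sub_Iic hi.integrableOn hi.integrableOn]
    ring

/-- The `L¹` modulus of continuity in time of a function with a bounded weak time derivative. -/
lemma SliceBound.lintegral_le (hγ : IsExpanding γ) (hft : SliceBound T γ M ft)
    (hftm : Measurable ft) {t t' a b : ℝ} (h0 : 0 < t) (htt' : t ≤ t') (hT : t' < T)
    (ha : 0 ≤ a) (hab : a ≤ b) (hb : b ≤ γ t) :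
    ∫⁻ x in Ioo a b, ‖∫ τ in t..t', ft (x, τ)‖ₑ ≤ ENNReal.ofReal ((t' - t) * (M * √(b - a))) := by
  calc ∫⁻ x in Ioo a b, ‖∫ τ in t..t', ft (x, τ)‖ₑ
      ≤ ∫⁻ x in Ioo a b, ∫⁻ τ in Ioc t t', ‖ft (x, τ)‖ₑ := by
        refine lintegral_mono fun x => ?_
        rw [intervalIntegral.integral_of_le htt']
        exact enorm_integral_le_lintegral_enorm _
    _ = ∫⁻ τ in Ioc t t', ∫⁻ x in Ioo a b, ‖ft (x, τ)‖ₑ := by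
        rw [lintegral_lintegral_swap]
        exact hftm.enorm.aemeasurable
    _ ≤ ∫⁻ τ in Ioc t t', ENNReal.ofReal (M * √(b - a)) := by
        refine setLIntegral_mono_ae measurable_const.aemeasurable ?_
        filter_upwards [hft] with τ hτ hτI
        exact hτ ⟨h0.trans hτI.1, hτI.2.trans_lt hT⟩ a b ha hab
          (hb.trans (hγ.monotone hτI.1.le))
    _ = ENNReal.ofReal ((t' - t) * (M * √(b - a))) := by
        rw [lintegral_const, Measure.restrict_apply_univ, Real.volume_Ioc,
          ENNReal.ofReal_mul (sub_nonneg.2 htt'), mul_comm]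

/-- Two functions with Hölder exponent `1/2` that are close in `L¹` on short intervals are
pointwise close. -/
lemma abs_sub_le_of_lintegral_le {w w' : ℝ → ℝ} {L k x : ℝ} (hM : 0 ≤ M) (hk : 0 < k) (hk1 : k ≤ L)
    (hw : ∀ x ∈ Icc 0 L, ∀ y ∈ Icc 0 L, |w x - w y| ≤ M * √|x - y|)
    (hw' : ∀ x ∈ Icc 0 L, ∀ y ∈ Icc 0 L, |w' x - w' y| ≤ M * √|x - y|)
    (hint : ∀ a b, 0 ≤ a → a ≤ b → b ≤ L →
      ∫⁻ x in Ioo a b, ‖w' x - w x‖ₑ ≤ ENNReal.ofReal (k * (M * √(b - a))))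
    (hx : x ∈ Icc 0 L) : |w' x - w x| ≤ 3 * M * √k := by
  -- An interval of length `k` around `x` within `[0, L]`. On it the difference drops by at most
  -- `2M√k` from its value at `x`, and its mean is at most `M√k`; hence the factor 3.
  obtain ⟨a, ha0, hab, hax, hxa⟩ : ∃ a, 0 ≤ a ∧ a + k ≤ L ∧ a ≤ x ∧ x ≤ a + k := by
    refine ⟨min x (L - k), le_min hx.1 (by linarith), ?_, min_le_left _ _, ?_⟩
    · linarith [min_le_right x (L - k)]
    · rcases min_cases x (L - k) with h | h <;> linarith [hx.2]
  have h1 : ∀ y ∈ Ioo a (a + k), |w' x - w x| - 2 * M * √k ≤ |w' y - w y| := by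
    intro y hy
    have hyL : y ∈ Icc 0 L := ⟨by linarith [hy.1], by linarith [hy.2]⟩
    have hs : √|x - y| ≤ √k := Real.sqrt_le_sqrt (abs_le.2 ⟨by linarith [hy.2], by linarith [hy.1]⟩)
    have e1 := hw x hx y hyL
    have e2 := hw' x hx y hyL
    have e3 : M * √|x - y| ≤ M * √k := mul_le_mul_of_nonneg_left hs hM
    have e4 : w' x - w x = (w' x - w' y) + (w' y - w y) - (w x - w y) := by ring
    have e5 : |w' x - w x| ≤ |w' x - w' y| + |w' y - w y| + |w x - w y| := by
      rw [e4]
      exact (abs_sub _ _).trans (add_le_add_left (abs_add_le _ _) _)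
    linarith
  have h2 : ENNReal.ofReal ((|w' x - w x| - 2 * M * √k) * k) ≤ ENNReal.ofReal (k * (M * √k)) := by
    calc ENNReal.ofReal ((|w' x - w x| - 2 * M * √k) * k)
        = ∫⁻ y in Ioo a (a + k), ENNReal.ofReal (|w' x - w x| - 2 * M * √k) := by
          rw [lintegral_const, Measure.restrict_apply_univ, Real.volume_Ioo, add_sub_cancel_left,
            ENNReal.ofReal_mul' hk.le]
      _ ≤ ∫⁻ y in Ioo a (a + k), ‖w' y - w y‖ₑ := by
          refine setLIntegral_mono' measurableSet_Ioo fun y hy => ?_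
          rw [Real.enorm_eq_ofReal_abs]
          exact ENNReal.ofReal_le_ofReal (h1 y hy)
      _ ≤ _ := by
          have := hint a (a + k) ha0 (by linarith) hab
          rwa [add_sub_cancel_left] at this
  rw [ENNReal.ofReal_le_ofReal_iff (by positivity), mul_comm k] at h2
  have := le_of_mul_le_mul_right h2 hk
  linarith

end

/-! ### Continuous extension from almost all time slices -/

/-- A retraction of the plane onto the closed moving domain, clamping first time, then space. -/
noncomputable def clampDomain (T : ℝ) (hT : 0 ≤ T) (γ : ℝ → ℝ) (z : ℝ × ℝ) : ℝ × ℝ :=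
  (max 0 (min z.1 (γ (projIcc 0 T hT z.2))), projIcc 0 T hT z.2)

section

variable {T M : ℝ} {γ : ℝ → ℝ}

lemma continuous_clampDomain (hT : 0 ≤ T) (hγ : IsExpanding γ) :
    Continuous (clampDomain T hT γ) := by
  have h1 : Continuous fun z : ℝ × ℝ => (projIcc 0 T hT z.2 : ℝ) :=
    continuous_subtype_val.comp (continuous_projIcc.comp continuous_snd)
  exact (continuous_const.max (continuous_fst.min (hγ.continuous.comp h1))).prodMk h1

lemma clampDomain_mem (hT : 0 ≤ T) (hγ : IsExpanding γ) (z : ℝ × ℝ) :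
    clampDomain T hT γ z ∈ closedMovingDomain T γ :=
  ⟨(projIcc 0 T hT z.2).2, le_max_left _ _, max_le (hγ.pos _).le (min_le_right _ _)⟩

lemma clampDomain_of_mem (hT : 0 ≤ T) {z : ℝ × ℝ} (hz : z ∈ closedMovingDomain T γ) :
    clampDomain T hT γ z = z := by
  have h1 : (projIcc 0 T hT z.2 : ℝ) = z.2 := by rw [projIcc_of_mem hT hz.1]
  ext
  · simp [clampDomain, h1, hz.2.1, hz.2.2]
  · simp [clampDomain, h1]

/-- A uniformly continuous function on almost all time slices of the moving domain extends to a
continuous function on the plane. -/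
lemma exists_continuous_extension (hT : 0 < T) (hγ : IsExpanding γ) {S : Set ℝ}
    (hS : ∀ᵐ t : ℝ, t ∈ Ioo 0 T → t ∈ S) {w : ℝ → ℝ → ℝ}
    (huc : ∀ t ∈ S ∩ Ioo 0 T, ∀ t' ∈ S ∩ Ioo 0 T, t ≤ t' → t' ≤ t + 1 →
      ∀ x ∈ Icc 0 (γ t), ∀ x' ∈ Icc 0 (γ t'),
        |w t' x' - w t x| ≤ M * √|x' - x| + 3 * M * √(t' - t)) :
    ∃ v : ℝ × ℝ → ℝ, Continuous v ∧
      ∀ t ∈ S ∩ Ioo 0 T, ∀ x ∈ Icc 0 (γ t), v (x, t) = w t x := by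
  set G : Set (ℝ × ℝ) := {z | z.2 ∈ S ∩ Ioo 0 T ∧ z.1 ∈ Icc 0 (γ z.2)} with hG
  set W : ℝ × ℝ → ℝ := fun z => w z.2 z.1 with hW
  have hUC : UniformContinuousOn W G := by
    rw [Metric.uniformContinuousOn_iff]
    intro ε hε
    have hlim : Tendsto (fun δ : ℝ => M * √δ + 3 * M * √δ) (𝓝[>] 0) (𝓝 0) := by
      have : Continuous fun δ : ℝ => M * √δ + 3 * M * √δ := by fun_prop
      simpa using (this.tendsto 0).mono_left nhdsWithin_le_nhds
    -- The sign of `M` is not assumed; for `M < 0` the bound itself is nonpositive.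
    have hMnn : 0 ≤ M ∨ M < 0 := le_or_gt 0 M
    obtain ⟨δ, hδ1, hδ0, hδ2⟩ := ((hlim.eventually (gt_mem_nhds hε)).and
      (Ioo_mem_nhdsGT (one_pos (α := ℝ)))).exists
    refine ⟨δ, hδ0, fun z hz z' hz' hd => ?_⟩
    have key : ∀ z ∈ G, ∀ z' ∈ G, dist z z' < δ → z.2 ≤ z'.2 → |W z' - W z| < ε := by
      intro z hz z' hz' hd hle
      have hd' := max_lt_iff.1 (Prod.dist_eq (x := z) (y := z') ▸ hd)
      rw [Real.dist_eq, Real.dist_eq, abs_sub_comm, abs_sub_comm z.2] at hd'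
      have ht := (abs_lt.1 hd'.2).2
      have h1 := huc _ hz.1 _ hz'.1 hle (by linarith) _ hz.2 _ hz'.2
      rcases hMnn with hM | hM
      · have e1 : √|z'.1 - z.1| ≤ √δ := Real.sqrt_le_sqrt hd'.1.le
        have e2 : √(z'.2 - z.2) ≤ √δ := Real.sqrt_le_sqrt ht.le
        have e3 : M * √|z'.1 - z.1| ≤ M * √δ := mul_le_mul_of_nonneg_left e1 hM
        have e4 : 3 * M * √(z'.2 - z.2) ≤ 3 * M * √δ :=
          mul_le_mul_of_nonneg_left e2 (by positivity)
        exact (h1.trans (add_le_add e3 e4)).trans_lt hδ1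
      · have e1 : M * √|z'.1 - z.1| ≤ 0 := mul_nonpos_of_nonpos_of_nonneg hM.le (Real.sqrt_nonneg _)
        have e2 : M * √(z'.2 - z.2) ≤ 0 := mul_nonpos_of_nonpos_of_nonneg hM.le (Real.sqrt_nonneg _)
        exact lt_of_le_of_lt (by linarith) hε
    rw [Real.dist_eq]
    rcases le_total z.2 z'.2 with h | h
    · rw [abs_sub_comm]
      exact key z hz z' hz' hd h
    · exact key z' hz' z hz (by rwa [dist_comm]) h
  have hSd : Icc 0 T ⊆ closure (S ∩ Ioo 0 T) := by
    have h1 : Dense {t | t ∈ Ioo 0 T → t ∈ S} := Measure.dense_of_ae hS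
    have h2 := h1.open_subset_closure_inter (isOpen_Ioo (a := 0) (b := T))
    rw [← closure_Ioo hT.ne]
    refine closure_minimal (h2.trans (closure_mono ?_)) isClosed_closure
    exact fun t ht => ⟨ht.2 ht.1, ht.1⟩
  have hcl : closedMovingDomain T γ ⊆ closure G := by
    intro z hz
    -- A point of the closed domain is approached through good times `s`; truncating its abscissa at
    -- `γ s` keeps the approximating points in their slices.
    have hc : Continuous fun s : ℝ => (min z.1 (γ s), s) :=
      (continuous_const.min hγ.continuous).prodMk continuous_id
    have h1 : (min z.1 (γ z.2), z.2) ∈ closure G :=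
      map_mem_closure (f := fun s : ℝ => (min z.1 (γ s), s)) hc (hSd hz.1) fun s hs =>
        ⟨hs, le_min hz.2.1 (hγ.pos _).le, min_le_right _ _⟩
    rwa [min_eq_left hz.2.2] at h1
  have hGcl : G ⊆ closedMovingDomain T γ := fun z hz => ⟨Ioo_subset_Icc_self hz.1.2, hz.2⟩
  have hcont : ContinuousOn (extendFrom G W) (closedMovingDomain T γ) := by
    refine continuousOn_extendFrom hcl fun z hz => ?_
    have : (𝓝[G] z).NeBot := mem_closure_iff_nhdsWithin_neBot.1 (hcl hz)
    have hcau : Cauchy (Filter.map W (𝓝[G] z)) := by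
      refine Cauchy.map_of_le (cauchy_nhds.mono nhdsWithin_le_nhds) hUC ?_
      exact le_principal_iff.2 self_mem_nhdsWithin
    exact CompleteSpace.complete hcau
  refine ⟨extendFrom G W ∘ clampDomain T hT.le γ, ?_, ?_⟩
  · exact hcont.comp_continuous (continuous_clampDomain hT.le hγ) (clampDomain_mem hT.le hγ)
  · intro t ht x hx
    have hz : (x, t) ∈ G := ⟨ht, hx⟩
    rw [Function.comp_apply, clampDomain_of_mem hT.le (hGcl hz)]
    exact extendFrom_eq (subset_closure hz) (hUC.continuousOn _ hz)

/-- **Continuity up to the boundary.** A function on the moving domain whose first weak derivatives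
are square integrable in space, uniformly in time, has a continuous representative. -/
theorem exists_continuous_representative {f fx ft : ℝ × ℝ → ℝ} (hT : 0 < T) (hγ : IsExpanding γ)
    (hM : 0 ≤ M)
    (hwx : HasWeakDeriv (movingDomain T γ) (1, 0) f fx)
    (hwt : HasWeakDeriv (movingDomain T γ) (0, 1) f ft)
    (hf : Integrable f) (hfx : Integrable fx) (hft : Integrable ft)
    (hfm : Measurable f) (hfxm : Measurable fx) (hftm : Measurable ft)
    (hbx : SliceBound T γ M fx) (hbt : SliceBound T γ M ft) :
    ∃ v : ℝ × ℝ → ℝ, Continuous v ∧ ∀ᵐ z, z ∈ movingDomain T γ → v z = f z := by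
  obtain ⟨S, hS, hSt⟩ := hwt.ae_slice_snd hγ hf hft hfm hftm
  have hx : ∀ᵐ t : ℝ, t ∈ Ioo 0 T → ∃ w : ℝ → ℝ,
      (∀ x ∈ Icc 0 (γ t), ∀ y ∈ Icc 0 (γ t), |w x - w y| ≤ M * √|x - y|) ∧
      ∀ᵐ x : ℝ, x ∈ Ioo 0 (γ t) → f (x, t) = w x := by
    filter_upwards [hwx.ae_slice_fst hγ hf hfx hfm hfxm, hbx] with t ht hb htT
    obtain ⟨hi, c, hc⟩ := ht htT
    refine ⟨fun x => c + ∫ y in (0 : ℝ)..x, fx (y, t), ?_, hc⟩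
    have key : ∀ x ∈ Icc 0 (γ t), ∀ y ∈ Icc 0 (γ t), x ≤ y →
        |(∫ w in (0 : ℝ)..y, fx (w, t)) - ∫ w in (0 : ℝ)..x, fx (w, t)| ≤ M * √(y - x) := by
      intro x hx y hy hxy
      rw [intervalIntegral.integral_interval_sub_left hi.intervalIntegrable hi.intervalIntegrable,
        intervalIntegral.integral_of_le hxy, integral_Ioc_eq_integral_Ioo]
      have h1 := (enorm_integral_le_lintegral_enorm (μ := volume.restrict (Ioo x y))
        fun w => fx (w, t)).trans (hb htT x y hx.1 hxy hy.2)
      rw [Real.enorm_eq_ofReal_abs, ENNReal.ofReal_le_ofReal_iff (by positivity)] at h1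
      exact h1
    intro x hx y hy
    rw [add_sub_add_left_eq_sub]
    rcases le_total x y with h | h
    · rw [abs_sub_comm, abs_sub_comm x, abs_of_nonneg (sub_nonneg.2 h)]
      exact key x hx y hy h
    · rw [abs_of_nonneg (sub_nonneg.2 h)]
      exact key y hy x hx h
  set S' : Set ℝ := {t | t ∈ S ∧ ∃ w : ℝ → ℝ,
      (∀ x ∈ Icc 0 (γ t), ∀ y ∈ Icc 0 (γ t), |w x - w y| ≤ M * √|x - y|) ∧
      ∀ᵐ x : ℝ, x ∈ Ioo 0 (γ t) → f (x, t) = w x} with hS'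
  have hSS : ∀ᵐ t : ℝ, t ∈ Ioo 0 T → t ∈ S' := by
    filter_upwards [hS, hx] with t h1 h2 h3 using ⟨h1, h2 h3⟩
  have hch : ∀ t : ℝ, ∃ w : ℝ → ℝ, t ∈ S' →
      (∀ x ∈ Icc 0 (γ t), ∀ y ∈ Icc 0 (γ t), |w x - w y| ≤ M * √|x - y|) ∧
      ∀ᵐ x : ℝ, x ∈ Ioo 0 (γ t) → f (x, t) = w x := by
    intro t
    by_cases h : t ∈ S'
    · exact h.2.imp fun w hw _ => hw
    · exact ⟨0, fun h' => (h h').elim⟩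
  choose w hw using hch
  obtain ⟨v, hv, hvw⟩ := exists_continuous_extension (M := M) (w := w) hT hγ hSS (by
    intro t ht t' ht' htt' htt1 x hx x' hx'
    have hxt' : x ∈ Icc 0 (γ t') := ⟨hx.1, hx.2.trans (hγ.monotone htt')⟩
    have h1 := (hw t' ht'.1).1 x' hx' x hxt'
    have h2 : |w t' x - w t x| ≤ 3 * M * √(t' - t) := by
      rcases htt'.eq_or_lt with rfl | hlt
      · simp
      -- The averaging length is `t' - t`, which fits in the earlier slice because `t' - t ≤ 1 ≤ γ
      -- t`.
      refine abs_sub_le_of_lintegral_le (L := γ t) hM (sub_pos.2 hlt)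
        ((by linarith : t' - t ≤ 1).trans (hγ.one_le t)) (hw t ht.1).1 ?_ ?_ hx
      · exact fun x hx y hy => (hw t' ht'.1).1 x ⟨hx.1, hx.2.trans (hγ.monotone htt')⟩ y
          ⟨hy.1, hy.2.trans (hγ.monotone htt')⟩
      · intro a b ha hab hb
        refine le_trans (le_of_eq ?_)
          (hbt.lintegral_le hγ hftm ht.2.1 htt' ht'.2.2 ha hab hb)
        refine setLIntegral_congr_fun_ae measurableSet_Ioo ?_
        filter_upwards [(hw t ht.1).2, (hw t' ht'.1).2,
          hSt t ht.1.1 t' ht'.1.1 ht.2.1 htt' ht'.2.2] with y e1 e2 e3 hy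
        have hy1 : y ∈ Ioo 0 (γ t) := ⟨ha.trans_lt hy.1, hy.2.trans_le hb⟩
        rw [← e3 hy1, e1 hy1, e2 ⟨hy1.1, hy1.2.trans_le (hγ.monotone htt')⟩]
    have h3 : w t' x' - w t x = (w t' x' - w t' x) + (w t' x - w t x) := by ring
    rw [h3]
    exact (abs_add_le _ _).trans (add_le_add h1 h2))
  refine ⟨v, hv, ae_of_ae_ae_fst ?_ ?_⟩
  · simp only [imp_iff_not_or, ofPred_or]
    exact (hγ.isOpen T).measurableSet.compl.union (measurableSet_eq_fun hv.measurable hfm)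
  · filter_upwards [hSS] with t ht
    by_cases htT : t ∈ Ioo 0 T
    · filter_upwards [(hw t (ht htT)).2] with x hx hz
      rw [hvw t ⟨ht htT, htT⟩ x (Ioo_subset_Icc_self hz.2), hx hz.2]
    · exact Eventually.of_forall fun x hz => (htT hz.1).elim

end

/-! ### Representatives as primitives, and globally integrable versions -/

section

variable {T M : ℝ} {γ : ℝ → ℝ} {f fx ft v : ℝ × ℝ → ℝ}

/-- Along almost every horizontal line, the continuous representative is a primitive of the weak
space derivative. -/
theorem HasWeakDeriv.ae_eq_integral_fst (hγ : IsExpanding γ)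
    (h : HasWeakDeriv (movingDomain T γ) (1, 0) f fx) (hf : Integrable f) (hfx : Integrable fx)
    (hfm : Measurable f) (hfxm : Measurable fx) (hv : Continuous v)
    (hvf : ∀ᵐ z, z ∈ movingDomain T γ → v z = f z) :
    ∀ᵐ t : ℝ, t ∈ Ioo 0 T → (Integrable fun x => fx (x, t)) ∧
      ∀ x ∈ Icc 0 (γ t), v (x, t) = v (0, t) + ∫ y in (0 : ℝ)..x, fx (y, t) := by
  filter_upwards [h.ae_slice_fst hγ hf hfx hfm hfxm, ae_ae_fst_of_ae hvf] with t ht htv htT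
  obtain ⟨hi, c, hc⟩ := ht htT
  have key : EqOn (fun x => v (x, t)) (fun x => c + ∫ y in (0 : ℝ)..x, fx (y, t))
      (Icc 0 (γ t)) := by
    refine Measure.eqOn_Icc_of_ae_eq (μ := volume) (hγ.pos t).ne ?_ (by fun_prop) ?_
    · rw [← restrict_Ioo_eq_restrict_Icc]
      refine (ae_restrict_iff' measurableSet_Ioo).2 ?_
      filter_upwards [hc, htv] with x h1 h2 hx
      rw [h2 ⟨htT, hx⟩, h1 hx]
    · exact (continuous_const.add
        (intervalIntegral.continuous_primitive (fun _ _ => hi.intervalIntegrable) 0)).continuousOn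
  refine ⟨hi, fun x hx => ?_⟩
  have h0 := key (left_mem_Icc.2 (hγ.pos t).le)
  have h1 := key hx
  simp only [intervalIntegral.integral_same, add_zero] at h0 h1
  rw [h1, h0]

/-- Along almost every vertical line, the continuous representative is a primitive of the weak
time derivative. -/
theorem HasWeakDeriv.ae_eq_integral_snd (hγ : IsExpanding γ)
    (h : HasWeakDeriv (movingDomain T γ) (0, 1) f ft) (hf : Integrable f) (hft : Integrable ft)
    (hfm : Measurable f) (hftm : Measurable ft) (hv : Continuous v)
    (hvf : ∀ᵐ z, z ∈ movingDomain T γ → v z = f z) {s : ℝ} (hs : 0 ≤ s) (hsT : s < T) :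
    ∀ᵐ x : ℝ, x ∈ Ioo 0 (γ s) → (Integrable fun τ => ft (x, τ)) ∧
      ∀ t ∈ Icc s T, v (x, t) = v (x, s) + ∫ τ in s..t, ft (x, τ) := by
  obtain ⟨c, hc⟩ := h.ae_eq_add_integral_snd hγ hf hft hfm hftm hs hsT
  filter_upwards [ae_ae_snd_of_ae hc, ae_ae_snd_of_ae hvf, hft.prod_right_ae] with x hx hxv hi hxI
  have hdiff : ∀ t, ∫ τ in Iic t, ft (x, τ) =
      (∫ τ in Iic s, ft (x, τ)) + ∫ τ in s..t, ft (x, τ) := by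
    intro t
    rw [← intervalIntegral.integral_Iic_sub_Iic hi.integrableOn hi.integrableOn]
    ring
  have key : EqOn (fun t => v (x, t))
      (fun t => c x + (∫ τ in Iic s, ft (x, τ)) + ∫ τ in s..t, ft (x, τ)) (Icc s T) := by
    refine Measure.eqOn_Icc_of_ae_eq (μ := volume) hsT.ne ?_ (by fun_prop) ?_
    · rw [← restrict_Ioo_eq_restrict_Icc]
      refine (ae_restrict_iff' measurableSet_Ioo).2 ?_
      filter_upwards [hx, hxv] with t h1 h2 ht
      rw [h2 ⟨⟨hs.trans_lt ht.1, ht.2⟩, hxI.1, hxI.2.trans_le (hγ.monotone ht.1.le)⟩, h1 hxI ht,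
        hdiff t, add_assoc]
    · exact (continuous_const.add
        (intervalIntegral.continuous_primitive (fun _ _ => hi.intervalIntegrable) s)).continuousOn
  refine ⟨hi, fun t ht => ?_⟩
  have h0 := key (left_mem_Icc.2 hsT.le)
  have h1 := key ht
  simp only [intervalIntegral.integral_same, add_zero] at h0 h1
  rw [h1, h0]

/-- Measurable and globally integrable version of a function of class `L^∞(0, T; L²(Ω_t))`. -/
lemma MemLinftyL2.exists_measurable (hγ : IsExpanding γ) (hf : MemLinftyL2 T γ f) :
    ∃ f' : ℝ × ℝ → ℝ, Measurable f' ∧ Integrable f' ∧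
      f =ᵐ[volume.restrict (movingDomain T γ)] f' ∧ ∃ M, 0 ≤ M ∧ SliceBound T γ M f' := by
  have hU := (hγ.isOpen T).measurableSet
  set f' : ℝ × ℝ → ℝ := (movingDomain T γ).indicator (hf.aestronglyMeasurable.mk f) with hf'
  have hm : Measurable f' := hf.aestronglyMeasurable.measurable_mk.indicator hU
  have hae : f =ᵐ[volume.restrict (movingDomain T γ)] f' := by
    filter_upwards [hf.aestronglyMeasurable.ae_eq_mk, ae_restrict_mem hU] with z h1 h2
    rw [hf', indicator_of_mem h2, h1]
  obtain ⟨M, hM⟩ := hf.bound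
  have hbd : SliceBound T γ M f' := by
    filter_upwards [(ae_restrict_iff' measurableSet_Ioo).1 hM,
      ae_ae_fst_of_ae ((ae_restrict_iff' hU).1 hae)] with t h1 h2 htT a b ha hab hb
    have hsub : Ioo a b ⊆ Ioo 0 (γ t) := Ioo_subset_Ioo ha hb
    have h3 : eLpNorm (fun x => f' (x, t)) 2 (volume.restrict (Ioo 0 (γ t))) ≤ M := by
      rw [← eLpNorm_congr_ae (f := fun x => f (x, t))]
      · exact h1 htT
      · refine (ae_restrict_iff' measurableSet_Ioo).2 ?_
        filter_upwards [h2] with x hx hxI using hx ⟨htT, hxI⟩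
    have hmt : AEStronglyMeasurable (fun x => f' (x, t)) (volume.restrict (Ioo a b)) :=
      (hm.comp (by fun_prop : Measurable fun x : ℝ => (x, t))).aestronglyMeasurable
    -- Cauchy–Schwarz on `(a, b)`: the exponent `1/1 - 1/2` produces the factor `√(b - a)`.
    have h4 := eLpNorm_le_eLpNorm_mul_rpow_measure_univ (p := 1) (q := 2) (by norm_num) hmt
    rw [eLpNorm_one_eq_lintegral_enorm, Measure.restrict_apply_univ, Real.volume_Ioo] at h4
    refine h4.trans ?_
    have h5 := (eLpNorm_mono_measure (fun x => f' (x, t))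
      (Measure.restrict_mono_set volume hsub)).trans h3
    have h6 : ENNReal.ofReal (b - a) ^ (1 / (1 : ℝ≥0∞).toReal - 1 / (2 : ℝ≥0∞).toReal)
        = ENNReal.ofReal √(b - a) := by
      rw [Real.sqrt_eq_rpow, ENNReal.ofReal_rpow_of_nonneg (by linarith) (by norm_num)]
      norm_num
    rw [h6, ENNReal.ofReal_mul M.coe_nonneg, ENNReal.ofReal_coe_nnreal]
    exact mul_le_mul_left h5 _
  refine ⟨f', hm, ⟨hm.aestronglyMeasurable, ?_⟩, hae, M, M.2, hbd⟩
  rw [hasFiniteIntegral_iff_enorm]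
  have h1 : ∫⁻ z, ‖f' z‖ₑ = ∫⁻ t : ℝ, ∫⁻ x : ℝ, ‖f' (x, t)‖ₑ :=
    lintegral_prod_symm _ hm.enorm.aemeasurable
  rw [h1]
  calc ∫⁻ t : ℝ, ∫⁻ x : ℝ, ‖f' (x, t)‖ₑ
      ≤ ∫⁻ t : ℝ, (Ioo 0 T).indicator (fun _ => ENNReal.ofReal (M * √(γ T))) t := by
        refine lintegral_mono_ae ?_
        filter_upwards [hbd] with t ht
        by_cases htT : t ∈ Ioo 0 T
        · rw [indicator_of_mem htT]
          have h2 : ∫⁻ x : ℝ, ‖f' (x, t)‖ₑ = ∫⁻ x in Ioo 0 (γ t), ‖f' (x, t)‖ₑ := by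
            rw [← lintegral_indicator measurableSet_Ioo]
            congr 1 with x
            by_cases hx : x ∈ Ioo 0 (γ t)
            · rw [indicator_of_mem hx]
            · have : (x, t) ∉ movingDomain T γ := fun h => hx h.2
              rw [indicator_of_notMem hx, hf', indicator_of_notMem this, enorm_zero]
          rw [h2]
          refine (ht htT 0 (γ t) le_rfl (hγ.pos t).le le_rfl).trans ?_
          refine ENNReal.ofReal_le_ofReal (mul_le_mul_of_nonneg_left ?_ M.2)
          exact Real.sqrt_le_sqrt (by linarith [hγ.monotone htT.2.le])
        · have h2 : ∀ x, f' (x, t) = 0 := fun x => by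
            have : (x, t) ∉ movingDomain T γ := fun h => htT h.1
            rw [hf', indicator_of_notMem this]
          simp [h2]
    _ = ENNReal.ofReal (M * √(γ T)) * ENNReal.ofReal (T - 0) := by
        rw [lintegral_indicator measurableSet_Ioo, lintegral_const, Measure.restrict_apply_univ,
          Real.volume_Ioo]
    _ < ⊤ := ENNReal.mul_lt_top ENNReal.ofReal_lt_top ENNReal.ofReal_lt_top

end

/-! ### Mixed derivatives and the zero trace -/

/-- Weak derivatives commute. -/
lemma HasWeakDeriv.mixed {U : Set (ℝ × ℝ)} {e e' : ℝ × ℝ} {f g g' k : ℝ × ℝ → ℝ}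
    (h : HasWeakDeriv U e f g) (h' : HasWeakDeriv U e' f g') (hk : HasWeakDeriv U e g' k) :
    HasWeakDeriv U e' g k where
  locallyIntegrableOn := h.locallyIntegrableOn_deriv
  locallyIntegrableOn_deriv := hk.locallyIntegrableOn_deriv
  integral_eq φ hφ hφc hφU := by
    have hsm : ∀ w : ℝ × ℝ, ContDiff ℝ ∞ fun p => fderiv ℝ φ p w := fun w =>
      (hφ.fderiv_right (m := ∞) (by simp)).clm_apply contDiff_const
    have hcs : ∀ w : ℝ × ℝ, HasCompactSupport fun p => fderiv ℝ φ p w := fun w =>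
      hφc.fderiv_apply ℝ w
    have hts : ∀ w : ℝ × ℝ, tsupport (fun p => fderiv ℝ φ p w) ⊆ U := fun w =>
      (tsupport_fderiv_apply_subset ℝ w).trans hφU
    have hsymm : ∀ p, fderiv ℝ (fun p => fderiv ℝ φ p e') p e
        = fderiv ℝ (fun p => fderiv ℝ φ p e) p e' := by
      intro p
      have hd : DifferentiableAt ℝ (fderiv ℝ φ) p :=
        ((hφ.fderiv_right (m := ∞) (by simp)).differentiable (by simp)).differentiableAt
      have h1 : ∀ w w' : ℝ × ℝ, fderiv ℝ (fun p => fderiv ℝ φ p w) p w'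
          = fderiv ℝ (fderiv ℝ φ) p w' w := by
        intro w w'
        rw [fderiv_clm_apply hd (differentiableAt_const w)]
        simp
      rw [h1, h1]
      exact (hφ.contDiffAt.isSymmSndFDerivAt (by
        rw [minSmoothness_of_isRCLikeNormedField]
        exact WithTop.coe_le_coe.2 (le_top (a := (2 : ℕ∞))))) e e'
    -- With derivatives of `φ` as test functions and symmetry of its second derivative, `∫ g ∂_{e'}φ
    -- = -∫ f ∂_e∂_{e'}φ = ∫ g' ∂_eφ = -∫ k φ`.
    have e1 := h.integral_eq _ (hsm e') (hcs e') (hts e')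
    have e2 := h'.integral_eq _ (hsm e) (hcs e) (hts e)
    have e3 := hk.integral_eq _ hφ hφc hφU
    simp_rw [hsymm] at e1
    linarith

/-- Functions of class `H¹₀` vanish at the end points. -/
lemma MemH10.eq_zero {L : ℝ} (hL : 0 < L) {f w : ℝ → ℝ} (hf : MemH10 (Ioo 0 L) f)
    (hw : Continuous w) (hfw : ∀ᵐ x : ℝ, x ∈ Ioo 0 L → w x = f x) : w 0 = 0 ∧ w L = 0 := by
  obtain ⟨hf2, g, hg, φ, hφ, hφf, hφg⟩ := hf
  set μ := volume.restrict (Ioo 0 L) with hμ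
  have hcont : ∀ n, Continuous (deriv (φ n)) := fun n => (hφ n).1.continuous_deriv (by simp)
  have hdm : ∀ n, AEStronglyMeasurable (deriv (φ n)) μ := fun n => (hcont n).aestronglyMeasurable
  -- The derivatives of `φ n` are eventually bounded in `L²` by `‖g‖ + 1`. With the zeros of `φ n`
  -- at both ends this gives `|φ n x| ≤ B√x` and `|φ n x| ≤ B√(L - x)`, which pass to `w` along an
  -- almost everywhere convergent subsequence.
  obtain ⟨B, hB0, hB⟩ : ∃ B : ℝ, 0 ≤ B ∧
      ∀ᶠ n in atTop, eLpNorm (deriv (φ n)) 2 μ ≤ ENNReal.ofReal B := by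
    refine ⟨(eLpNorm g 2 μ + 1).toReal, ENNReal.toReal_nonneg, ?_⟩
    filter_upwards [hφg.eventually (gt_mem_nhds (one_pos : (0 : ℝ≥0∞) < 1))] with n hn
    rw [ENNReal.ofReal_toReal (by finiteness [hg.2])]
    have h1 : deriv (φ n) = g - fun x => g x - deriv (φ n) x := by ext x; simp
    rw [h1]
    exact (eLpNorm_sub_le hg.1 (hg.1.sub (hdm n)) one_le_two).trans (add_le_add_right hn.le _)
  have hint : ∀ n, eLpNorm (deriv (φ n)) 2 μ ≤ ENNReal.ofReal B → ∀ a b, 0 ≤ a → a ≤ b → b ≤ L →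
      |φ n b - φ n a| ≤ B * √(b - a) := by
    intro n hn a b ha hab hb
    have hsub : Ioo a b ⊆ Ioo 0 L := Ioo_subset_Ioo ha hb
    have hftc : ∫ x in a..b, deriv (φ n) x = φ n b - φ n a :=
      intervalIntegral.integral_deriv_eq_sub
        (fun x _ => ((hφ n).1.differentiable (by simp)).differentiableAt)
        ((hcont n).intervalIntegrable _ _)
    have h4 := eLpNorm_le_eLpNorm_mul_rpow_measure_univ (p := 1) (q := 2) (by norm_num)
      ((hcont n).aestronglyMeasurable (μ := volume.restrict (Ioo a b)))
    rw [eLpNorm_one_eq_lintegral_enorm, Measure.restrict_apply_univ, Real.volume_Ioo] at h4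
    have h5 := (eLpNorm_mono_measure (deriv (φ n))
      (Measure.restrict_mono_set volume hsub)).trans hn
    have h6 : ENNReal.ofReal (b - a) ^ (1 / (1 : ℝ≥0∞).toReal - 1 / (2 : ℝ≥0∞).toReal)
        = ENNReal.ofReal √(b - a) := by
      rw [Real.sqrt_eq_rpow, ENNReal.ofReal_rpow_of_nonneg (by linarith) (by norm_num)]
      norm_num
    rw [h6] at h4
    have h7 := (enorm_integral_le_lintegral_enorm (μ := volume.restrict (Ioo a b))
        (deriv (φ n))).trans (h4.trans (mul_le_mul_left h5 _))
    rw [← ENNReal.ofReal_mul hB0, Real.enorm_eq_ofReal_abs,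
      ENNReal.ofReal_le_ofReal_iff (by positivity), ← integral_Ioc_eq_integral_Ioo,
      ← intervalIntegral.integral_of_le hab, hftc] at h7
    exact h7
  have hend : ∀ n, φ n 0 = 0 ∧ φ n L = 0 := fun n =>
    ⟨image_eq_zero_of_notMem_tsupport fun h => lt_irrefl _ ((hφ n).2.2 h).1,
      image_eq_zero_of_notMem_tsupport fun h => lt_irrefl _ ((hφ n).2.2 h).2⟩
  have hmeas : TendstoInMeasure μ φ atTop f := by
    refine tendstoInMeasure_of_tendsto_eLpNorm two_ne_zero
      (fun n => (hφ n).1.continuous.aestronglyMeasurable) hf2.1 ?_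
    refine hφf.congr fun n => ?_
    rw [← eLpNorm_neg]
    congr 1
    ext x
    simp
  obtain ⟨ns, hns, hae⟩ := hmeas.exists_seq_tendsto_ae
  have hbound : ∀ᵐ x ∂μ, |w x| ≤ B * √x ∧ |w x| ≤ B * √(L - x) := by
    filter_upwards [hae, (ae_restrict_iff' measurableSet_Ioo).2 hfw,
      ae_restrict_mem measurableSet_Ioo] with x hx hwx hxI
    rw [hwx]
    have hev := hns.tendsto_atTop.eventually hB
    constructor
    · refine le_of_tendsto hx.abs (hev.mono fun n hn => ?_)
      have := hint _ hn 0 x le_rfl hxI.1.le hxI.2.le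
      rwa [(hend _).1, sub_zero, sub_zero] at this
    · refine le_of_tendsto hx.abs (hev.mono fun n hn => ?_)
      have := hint _ hn x L hxI.1.le hxI.2.le le_rfl
      rwa [(hend _).2, zero_sub, abs_neg] at this
  have key : ∀ F : ℝ → ℝ, Continuous F → (∀ᵐ x ∂μ, |w x| ≤ F x) → ∀ x ∈ Icc 0 L, |w x| ≤ F x := by
    intro F hF h x hx
    have := Measure.eqOn_Icc_of_ae_eq (μ := volume) (f := fun x => max |w x| (F x)) (g := F)
      hL.ne ?_
      (hw.abs.max hF).continuousOn hF.continuousOn hx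
    · exact max_eq_right_iff.1 this
    · rw [← restrict_Ioo_eq_restrict_Icc]
      filter_upwards [h] with x hx using max_eq_right hx
  constructor
  · have := key (fun x => B * √x) (by fun_prop) (hbound.mono fun x h => h.1) 0
      (left_mem_Icc.2 hL.le)
    simpa using this
  · have := key (fun x => B * √(L - x)) (by fun_prop) (hbound.mono fun x h => h.2) L
      (right_mem_Icc.2 hL.le)
    simpa using this

/-! ### Primitives of integrable functions -/

/-- On `[a, b]`, the function `f` is a primitive of the integrable function `f'`. -/
structure IsPrimitive (f f' : ℝ → ℝ) (a b : ℝ) : Prop where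
  intervalIntegrable : IntervalIntegrable f' volume a b
  eq_integral : ∀ t ∈ Icc a b, f t = f a + ∫ τ in a..t, f' τ

namespace IsPrimitive

variable {f f' g g' : ℝ → ℝ} {a b c : ℝ}

lemma integral_eq_sub (h : IsPrimitive f f' a b) (hab : a ≤ b) : ∫ τ in a..b, f' τ = f b - f a := by
  rw [h.eq_integral b (right_mem_Icc.2 hab)]
  ring

lemma mono (h : IsPrimitive f f' a b) (hac : a ≤ c) (hcb : c ≤ b) : IsPrimitive f f' a c where
  intervalIntegrable := h.intervalIntegrable.mono_set (by
    rw [uIcc_of_le hac, uIcc_of_le (hac.trans hcb)]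
    exact Icc_subset_Icc_right hcb)
  eq_integral t ht := h.eq_integral t ⟨ht.1, ht.2.trans hcb⟩

lemma add (hf : IsPrimitive f f' a b) (hg : IsPrimitive g g' a b) :
    IsPrimitive (fun t => f t + g t) (fun t => f' t + g' t) a b where
  intervalIntegrable := hf.intervalIntegrable.add hg.intervalIntegrable
  eq_integral t ht := by
    have h1 := hf.mono ht.1 ht.2
    have h2 := hg.mono ht.1 ht.2
    rw [intervalIntegral.integral_add h1.intervalIntegrable h2.intervalIntegrable,
      hf.eq_integral t ht, hg.eq_integral t ht]
    ring

lemma const_mul (hf : IsPrimitive f f' a b) (k : ℝ) :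
    IsPrimitive (fun t => k * f t) (fun t => k * f' t) a b where
  intervalIntegrable := hf.intervalIntegrable.const_mul k
  eq_integral t ht := by
    rw [intervalIntegral.integral_const_mul, hf.eq_integral t ht]
    ring

lemma congr_ae (hf : IsPrimitive f f' a b) (hab : a ≤ b)
    (hfg : ∀ᵐ t : ℝ, t ∈ Ioo a b → f' t = g' t) : IsPrimitive f g' a b := by
  have h1 : ∀ᵐ t : ℝ, t ∈ uIoc a b → f' t = g' t := by
    filter_upwards [hfg, Measure.ae_ne volume b] with t ht htb htI
    rw [uIoc_of_le hab] at htI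
    exact ht ⟨htI.1, lt_of_le_of_ne htI.2 htb⟩
  refine ⟨hf.intervalIntegrable.congr_ae ((ae_restrict_iff' measurableSet_uIoc).2 h1),
    fun t ht => ?_⟩
  rw [hf.eq_integral t ht]
  congr 1
  refine intervalIntegral.integral_congr_ae ?_
  filter_upwards [h1] with τ h2 hτ
  rw [uIoc_of_le ht.1] at hτ
  exact h2 (by rw [uIoc_of_le hab]; exact ⟨hτ.1, hτ.2.trans ht.2⟩)

/-- The product rule. -/
lemma mul (hab : a ≤ b) (hf : IsPrimitive f f' a b) (hg : IsPrimitive g g' a b) :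
    IsPrimitive (fun t => f t * g t) (fun t => f' t * g t + f t * g' t) a b := by
  -- `f` and `g` are controlled on `[a, b]` only; `F` and `G` agree with them there and are
  -- absolutely continuous, so integration by parts applies.
  set F : ℝ → ℝ := fun t => f a + ∫ τ in a..t, f' τ with hF
  set G : ℝ → ℝ := fun t => g a + ∫ τ in a..t, g' τ with hG
  have ac : ∀ {k : ℝ → ℝ} (C : ℝ), IntervalIntegrable k volume a b →
      AbsolutelyContinuousOnInterval (fun t => C + ∫ τ in a..t, k τ) a b := fun C hk =>
    ((LipschitzWith.const C).lipschitzOnWith (K := 0)).absolutelyContinuousOnInterval.fun_add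
      (hk.absolutelyContinuousOnInterval_intervalIntegral (c := a) (by simp))
  have hFac : AbsolutelyContinuousOnInterval F a b := ac _ hf.intervalIntegrable
  have hGac : AbsolutelyContinuousOnInterval G a b := ac _ hg.intervalIntegrable
  have hfF : EqOn f F (Icc a b) := hf.eq_integral
  have hgG : EqOn g G (Icc a b) := hg.eq_integral
  have hFd : ∀ᵐ t : ℝ, t ∈ Icc a b → deriv F t = f' t := by
    filter_upwards [hf.intervalIntegrable.ae_hasDerivAt_integral] with t ht htI
    rw [uIcc_of_le hab] at ht
    exact ((ht htI a (left_mem_Icc.2 hab)).const_add (f a)).deriv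
  have hGd : ∀ᵐ t : ℝ, t ∈ Icc a b → deriv G t = g' t := by
    filter_upwards [hg.intervalIntegrable.ae_hasDerivAt_integral] with t ht htI
    rw [uIcc_of_le hab] at ht
    exact ((ht htI a (left_mem_Icc.2 hab)).const_add (g a)).deriv
  have hfc : ContinuousOn f (uIcc a b) := by
    rw [uIcc_of_le hab]
    exact (uIcc_of_le hab ▸ hFac.continuousOn).congr hfF
  have hgc : ContinuousOn g (uIcc a b) := by
    rw [uIcc_of_le hab]
    exact (uIcc_of_le hab ▸ hGac.continuousOn).congr hgG
  refine ⟨(hf.intervalIntegrable.mul_continuousOn hgc).add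
    (hg.intervalIntegrable.continuousOn_mul hfc), fun t ht => ?_⟩
  have hsub : uIcc a t ⊆ uIcc a b := by
    rw [uIcc_of_le ht.1, uIcc_of_le hab]
    exact Icc_subset_Icc_right ht.2
  have h1 := (hFac.mono hsub).integral_deriv_mul_eq_sub (hGac.mono hsub)
  have h2 : ∫ x in a..t, deriv F x * G x + F x * deriv G x
      = ∫ x in a..t, f' x * g x + f x * g' x := by
    refine intervalIntegral.integral_congr_ae ?_
    filter_upwards [hFd, hGd] with x e1 e2 hx
    have hx' : x ∈ Icc a b := by
      rw [uIoc_of_le ht.1] at hx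
      exact ⟨hx.1.le, hx.2.trans ht.2⟩
    rw [e1 hx', e2 hx', hfF hx', hgG hx']
  rw [← h2, h1, hfF ht, hgG ht, hfF (left_mem_Icc.2 hab), hgG (left_mem_Icc.2 hab)]
  ring

/-- The chain rule for a primitive of a continuous function. -/
lemma comp (hf : IsPrimitive f f' a b) (hf' : Continuous f') {Φ φ : ℝ → ℝ}
    (hΦ : ∀ x, HasDerivAt Φ (φ x) x) (hφ : Continuous φ) (hab : a ≤ b) :
    IsPrimitive (fun t => Φ (f t)) (fun t => φ (f t) * f' t) a b := by
  set F : ℝ → ℝ := fun t => f a + ∫ τ in a..t, f' τ with hF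
  have hfF : EqOn f F (Icc a b) := hf.eq_integral
  have hFd : ∀ t, HasDerivAt F (f' t) t := fun t =>
    (intervalIntegral.integral_hasDerivAt_right (hf'.intervalIntegrable _ _)
      hf'.stronglyMeasurable.stronglyMeasurableAtFilter hf'.continuousAt).const_add _
  have hFc : Continuous F := continuous_iff_continuousAt.2 fun t => (hFd t).continuousAt
  have hc : Continuous fun t => φ (F t) * f' t := (hφ.comp hFc).mul hf'
  have hcongr : ∀ t ∈ Icc a b,
      EqOn (fun t => φ (F t) * f' t) (fun t => φ (f t) * f' t) (uIcc a t) := by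
    intro t ht τ hτ
    rw [uIcc_of_le ht.1] at hτ
    simp only [hfF ⟨hτ.1, hτ.2.trans ht.2⟩]
  refine ⟨(hc.intervalIntegrable a b).congr fun t ht => hcongr b (right_mem_Icc.2 hab)
    (uIoc_subset_uIcc ht), fun t ht => ?_⟩
  rw [← intervalIntegral.integral_congr (hcongr t ht),
    intervalIntegral.integral_eq_sub_of_hasDerivAt (f := fun t => Φ (F t))
      (fun τ _ => (hΦ (F τ)).comp τ (hFd τ)) (hc.intervalIntegrable _ _)]
  simp only [hfF ht, hfF (left_mem_Icc.2 hab)]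
  ring

end IsPrimitive

/-- Lipschitz functions are absolutely continuous. This lets the coefficient `β` enter the product
rule. -/
lemma LipschitzWith.isPrimitive_deriv {f : ℝ → ℝ} {K : ℝ≥0} (hf : LipschitzWith K f) (a b : ℝ) :
    IsPrimitive f (deriv f) a b where
  intervalIntegrable := (hf.lipschitzOnWith).absolutelyContinuousOnInterval.intervalIntegrable_deriv
  eq_integral t _ := by
    rw [(hf.lipschitzOnWith).absolutelyContinuousOnInterval.integral_deriv_eq_sub]
    ring

/-! ### Continuous representatives of strong solutions -/

/-- Continuous representatives `v, vx, vt` of a strong solution and of its first derivatives, with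
integrable second derivatives `gxx, gtx, gtt`. -/
structure IsContinuousSolution (a b ρ T : ℝ) (γ β : ℝ → ℝ)
    (v vx vt gxx gtx gtt : ℝ × ℝ → ℝ) : Prop where
  continuous : Continuous v
  continuous_fst : Continuous vx
  continuous_snd : Continuous vt
  integrable_xx : Integrable gxx
  integrable_tx : Integrable gtx
  integrable_tt : Integrable gtt
  line_fst : ∀ᵐ t : ℝ, t ∈ Ioo 0 T →
    IsPrimitive (fun x => v (x, t)) (fun x => vx (x, t)) 0 (γ t) ∧
    IsPrimitive (fun x => vx (x, t)) (fun x => gxx (x, t)) 0 (γ t) ∧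
    IsPrimitive (fun x => vt (x, t)) (fun x => gtx (x, t)) 0 (γ t)
  line_snd : ∀ s, 0 ≤ s → s < T → ∀ᵐ x : ℝ, x ∈ Ioo 0 (γ s) →
    IsPrimitive (fun t => v (x, t)) (fun t => vt (x, t)) s T ∧
    IsPrimitive (fun t => vx (x, t)) (fun t => gtx (x, t)) s T ∧
    IsPrimitive (fun t => vt (x, t)) (fun t => gtt (x, t)) s T
  equation : ∀ᵐ z : ℝ × ℝ, z ∈ movingDomain T γ →
    gtt z - gxx z + a * vt z + b * v z + β z.2 * (|v z| ^ ρ * v z) = 0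
  boundary : ∀ t ∈ Icc 0 T, v (0, t) = 0 ∧ v (γ t, t) = 0

lemma HasWeakDeriv.isPrimitive_fst {T : ℝ} {γ : ℝ → ℝ} {f fx v : ℝ × ℝ → ℝ} (hγ : IsExpanding γ)
    (h : HasWeakDeriv (movingDomain T γ) (1, 0) f fx) (hf : Integrable f) (hfx : Integrable fx)
    (hfm : Measurable f) (hfxm : Measurable fx) (hv : Continuous v)
    (hvf : ∀ᵐ z, z ∈ movingDomain T γ → v z = f z) :
    ∀ᵐ t : ℝ, t ∈ Ioo 0 T → IsPrimitive (fun x => v (x, t)) (fun x => fx (x, t)) 0 (γ t) := by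
  filter_upwards [h.ae_eq_integral_fst hγ hf hfx hfm hfxm hv hvf] with t ht htT
  exact ⟨(ht htT).1.intervalIntegrable, (ht htT).2⟩

lemma HasWeakDeriv.isPrimitive_snd {T : ℝ} {γ : ℝ → ℝ} {f ft v : ℝ × ℝ → ℝ} (hγ : IsExpanding γ)
    (h : HasWeakDeriv (movingDomain T γ) (0, 1) f ft) (hf : Integrable f) (hft : Integrable ft)
    (hfm : Measurable f) (hftm : Measurable ft) (hv : Continuous v)
    (hvf : ∀ᵐ z, z ∈ movingDomain T γ → v z = f z) {s : ℝ} (hs : 0 ≤ s) (hsT : s < T) :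
    ∀ᵐ x : ℝ, x ∈ Ioo 0 (γ s) → IsPrimitive (fun t => v (x, t)) (fun t => ft (x, t)) s T := by
  filter_upwards [h.ae_eq_integral_snd hγ hf hft hfm hftm hv hvf hs hsT] with x hx hxI
  exact ⟨(hx hxI).1.intervalIntegrable, (hx hxI).2⟩

/-- A continuous representative attains the initial value almost everywhere. -/
lemma HasInitialValue.ae_eq {T : ℝ} {γ : ℝ → ℝ} (hT : 0 < T) (hγ : IsExpanding γ)
    {f v : ℝ × ℝ → ℝ} {g : ℝ → ℝ} (h : HasInitialValue T f g) (hv : Continuous v)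
    (hvf : ∀ᵐ z, z ∈ movingDomain T γ → v z = f z) :
    ∀ᵐ x ∂(volume.restrict (Ioo (0 : ℝ) 1)), v (x, 0) = g x := by
  set μ := volume.restrict (Ioo (0 : ℝ) 1) with hμ
  -- Every neighbourhood of `0` meets `(0, T)` in positive measure; without this the limit would
  -- carry no information.
  have hne : (𝓝 (0 : ℝ) ⊓ ae (volume.restrict (Ioo 0 T))).NeBot := by
    rw [inf_neBot_iff]
    intro s hs s' hs'
    obtain ⟨l, hl, hls⟩ := exists_Ico_subset_of_mem_nhds hs ⟨1, one_pos⟩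
    have h1 : volume.restrict (Ioo 0 T) (Ioo 0 (min l T)) ≠ 0 := by
      rw [Measure.restrict_apply measurableSet_Ioo,
        inter_eq_left.2 (Ioo_subset_Ioo_right (min_le_right _ _)), Real.volume_Ioo]
      simp [hl, hT]
    obtain ⟨x, hx, hx'⟩ := ((frequently_ae_mem_iff.2 h1).and_eventually hs').exists
    exact ⟨x, hls ⟨hx.1.le, hx.2.trans_le (min_le_left _ _)⟩, hx'⟩
  have hvm : ∀ t, AEStronglyMeasurable (fun x => v (x, t)) μ := fun t =>
    (hv.comp (by fun_prop : Continuous fun x : ℝ => (x, t))).aestronglyMeasurable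
  have hev : ∀ᶠ t in 𝓝 (0 : ℝ) ⊓ ae (volume.restrict (Ioo 0 T)),
      eLpNorm (fun x => v (x, 0) - g x) 2 μ ≤ eLpNorm (fun x => v (x, 0) - v (x, t)) 2 μ
        + eLpNorm (fun x => f (x, t) - g x) 2 μ := by
    refine Filter.mem_inf_of_right ?_
    change ∀ᵐ t ∂(volume.restrict (Ioo 0 T)), _
    refine (ae_restrict_iff' measurableSet_Ioo).2 ?_
    filter_upwards [ae_ae_fst_of_ae hvf] with t ht htT
    have h1 : (fun x => f (x, t)) =ᵐ[μ] fun x => v (x, t) := by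
      refine (ae_restrict_iff' measurableSet_Ioo).2 ?_
      filter_upwards [ht] with x hx hxI
      exact (hx ⟨htT, hxI.1, hxI.2.trans_le (hγ.one_le t)⟩).symm
    have h2 : (fun x => v (x, 0) - g x)
        =ᵐ[μ] (fun x => v (x, 0) - v (x, t)) + fun x => f (x, t) - g x := by
      filter_upwards [h1] with x hx
      simp [hx]
    rw [eLpNorm_congr_ae h2]
    exact eLpNorm_add_le ((hvm 0).sub (hvm t))
      (((hvm t).congr h1.symm).sub h.1.1) one_le_two
  have hlim : Tendsto (fun t : ℝ => eLpNorm (fun x => v (x, 0) - v (x, t)) 2 μ) (𝓝 0) (𝓝 0) := by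
    have huc := (isCompact_Icc (a := (0 : ℝ)) (b := 1)).prod
      (isCompact_Icc (a := (-1 : ℝ)) (b := 1))
      |>.uniformContinuousOn_of_continuous hv.continuousOn
    rw [Metric.uniformContinuousOn_iff] at huc
    rw [ENNReal.tendsto_nhds_zero]
    intro ε hε
    obtain ⟨ε', hε'0, hε'⟩ := ENNReal.lt_iff_exists_nnreal_btwn.1 hε
    obtain ⟨δ, hδ, hd⟩ := huc ε' (by exact_mod_cast hε'0)
    filter_upwards [Metric.ball_mem_nhds (0 : ℝ) (lt_min hδ one_pos)] with t ht
    rw [Metric.mem_ball, Real.dist_eq, sub_zero, lt_min_iff] at ht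
    have h1 : ∀ᵐ x ∂μ, ‖v (x, 0) - v (x, t)‖ ≤ ε' := by
      filter_upwards [ae_restrict_mem measurableSet_Ioo] with x hx
      have := hd (x, 0) ⟨Ioo_subset_Icc_self hx, by simp⟩ (x, t)
        ⟨Ioo_subset_Icc_self hx, abs_le.1 ht.2.le⟩ (by simpa [Prod.dist_eq] using ht.1)
      exact this.le
    refine (eLpNorm_le_of_ae_bound h1).trans ?_
    simp only [hμ, Measure.restrict_apply_univ, Real.volume_Ioo]
    simpa using hε'.le
  have h0 : eLpNorm (fun x => v (x, 0) - g x) 2 μ = 0 := by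
    refine le_antisymm (ge_of_tendsto ?_ hev) bot_le
    simpa using (hlim.mono_left inf_le_left).add h.2
  filter_upwards [(eLpNorm_eq_zero_iff ((hvm 0).sub h.1.1) two_ne_zero).1 h0] with x hx
  exact sub_eq_zero.1 hx

/-- Strong solutions have continuous representatives. -/
theorem IsStrongSolution.exists_isContinuousSolution {a b ρ T : ℝ} {γ β u₀ u₁ : ℝ → ℝ}
    {u ux ut uxx utx utt : ℝ × ℝ → ℝ} (hT : 0 < T) (hγ : IsExpanding γ)
    (h : IsStrongSolution a b ρ T γ β u₀ u₁ u ux ut uxx utx utt) :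
    ∃ v vx vt gxx gtx gtt : ℝ × ℝ → ℝ, IsContinuousSolution a b ρ T γ β v vx vt gxx gtx gtt ∧
      v =ᵐ[volume.restrict (movingDomain T γ)] u ∧ vx =ᵐ[volume.restrict (movingDomain T γ)] ux ∧
      vt =ᵐ[volume.restrict (movingDomain T γ)] ut ∧
      ∀ᵐ x ∂(volume.restrict (Ioo (0 : ℝ) 1)), v (x, 0) = u₀ x ∧ vt (x, 0) = u₁ x := by
  have hU := (hγ.isOpen T).measurableSet
  obtain ⟨f, fm, fi, fu, Mf, fM0, fb⟩ := h.mem_u.exists_measurable hγ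
  obtain ⟨fx, fxm, fxi, fxu, Mfx, fxM0, fxb⟩ := h.mem_ux.exists_measurable hγ
  obtain ⟨ft, ftm, fti, ftu, Mft, ftM0, ftb⟩ := h.mem_ut.exists_measurable hγ
  obtain ⟨gxx, gxxm, gxxi, gxxu, Mgxx, gxxM0, gxxb⟩ := h.mem_uxx.exists_measurable hγ
  obtain ⟨gtx, gtxm, gtxi, gtxu, Mgtx, gtxM0, gtxb⟩ := h.mem_utx.exists_measurable hγ
  obtain ⟨gtt, gttm, gtti, gttu, Mgtt, gttM0, gttb⟩ := h.mem_utt.exists_measurable hγ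
  have hl : ∀ {k : ℝ × ℝ → ℝ}, Integrable k → LocallyIntegrableOn k (movingDomain T γ) :=
    fun hk => hk.locallyIntegrable.locallyIntegrableOn _
  have wx := h.weak_ux.congr fu fxu (hl fi) (hl fxi)
  have wt := h.weak_ut.congr fu ftu (hl fi) (hl fti)
  have wxx := h.weak_uxx.congr fxu gxxu (hl fxi) (hl gxxi)
  have wtx := h.weak_utx.congr ftu gtxu (hl fti) (hl gtxi)
  have wtt := h.weak_utt.congr ftu gttu (hl fti) (hl gtti)
  -- The solution class supplies only the space derivative of `u_t`; commuting derivatives makes it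
  -- also the time derivative of `u_x`, needed for the continuity of `u_x`.
  have wxt := wx.mixed wt wtx
  have hmono : ∀ {k : ℝ × ℝ → ℝ} {M M' : ℝ}, M ≤ M' → SliceBound T γ M k → SliceBound T γ M' k := by
    intro k M M' hMM hk
    filter_upwards [hk] with t ht htT a b ha hab hb
    refine (ht htT a b ha hab hb).trans (ENNReal.ofReal_le_ofReal ?_)
    exact mul_le_mul_of_nonneg_right hMM (Real.sqrt_nonneg _)
  obtain ⟨v, vc, vf⟩ := exists_continuous_representative hT hγ (le_max_of_le_left fxM0)
    wx wt fi fxi fti fm fxm ftm (hmono (le_max_left Mfx Mft) fxb) (hmono (le_max_right _ _) ftb)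
  obtain ⟨vx, vxc, vxf⟩ := exists_continuous_representative hT hγ (le_max_of_le_left gxxM0)
    wxx wxt fxi gxxi gtxi fxm gxxm gtxm (hmono (le_max_left Mgxx Mgtx) gxxb)
    (hmono (le_max_right _ _) gtxb)
  obtain ⟨vt, vtc, vtf⟩ := exists_continuous_representative hT hγ (le_max_of_le_left gtxM0)
    wtx wtt fti gtxi gtti ftm gtxm gttm (hmono (le_max_left Mgtx Mgtt) gtxb)
    (hmono (le_max_right _ _) gttb)
  have hrep : ∀ {k k' w : ℝ × ℝ → ℝ}, (∀ᵐ z, z ∈ movingDomain T γ → w z = k z) →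
      k' =ᵐ[volume.restrict (movingDomain T γ)] k →
      w =ᵐ[volume.restrict (movingDomain T γ)] k' := by
    intro k k' w h1 h2
    filter_upwards [(ae_restrict_iff' hU).2 h1, h2] with z e1 e2 using e1.trans e2.symm
  have vu := hrep vf fu
  have vxu := hrep vxf fxu
  have vtu := hrep vtf ftu
  refine ⟨v, vx, vt, gxx, gtx, gtt, ⟨vc, vxc, vtc, gxxi, gtxi, gtti, ?_, ?_, ?_, ?_⟩,
    vu, vxu, vtu, ?_⟩
  · filter_upwards [wx.isPrimitive_fst hγ fi fxi fm fxm vc vf,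
      wxx.isPrimitive_fst hγ fxi gxxi fxm gxxm vxc vxf,
      wtx.isPrimitive_fst hγ fti gtxi ftm gtxm vtc vtf, ae_ae_fst_of_ae vxf] with t h1 h2 h3 h4 htT
    refine ⟨(h1 htT).congr_ae (hγ.pos t).le ?_, h2 htT, h3 htT⟩
    filter_upwards [h4] with x hx hxI using (hx ⟨htT, hxI⟩).symm
  · intro s hs hsT
    filter_upwards [wt.isPrimitive_snd hγ fi fti fm ftm vc vf hs hsT,
      wxt.isPrimitive_snd hγ fxi gtxi fxm gtxm vxc vxf hs hsT,
      wtt.isPrimitive_snd hγ fti gtti ftm gttm vtc vtf hs hsT, ae_ae_snd_of_ae vtf]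
      with x h1 h2 h3 h4 hxI
    refine ⟨(h1 hxI).congr_ae hsT.le ?_, h2 hxI, h3 hxI⟩
    filter_upwards [h4] with t ht htI
    exact (ht ⟨⟨hs.trans_lt htI.1, htI.2⟩, hxI.1, hxI.2.trans_le (hγ.monotone htI.1.le)⟩).symm
  · refine (ae_restrict_iff' hU).1 ?_
    filter_upwards [h.equation, vu, vtu, gxxu, gttu] with z h1 h2 h3 h4 h5
    rw [h2, h3, ← h4, ← h5]
    exact h1
  -- The zero trace holds at almost every time, and extends to all of `[0, T]` by continuity.
  · have hae : ∀ᵐ t : ℝ, t ∈ Ioo 0 T → v (0, t) = 0 ∧ v (γ t, t) = 0 := by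
      filter_upwards [(ae_restrict_iff' measurableSet_Ioo).1 h.boundary,
        ae_ae_fst_of_ae ((ae_restrict_iff' hU).1 vu)] with t h1 h2 htT
      refine (h1 htT).eq_zero (hγ.pos t) (w := fun x => v (x, t)) (by fun_prop) ?_
      filter_upwards [h2] with x hx hxI using hx ⟨htT, hxI⟩
    have hγc := hγ.continuous
    have h0 : EqOn (fun t => v (0, t)) (fun _ => (0 : ℝ)) (Icc 0 T) := by
      refine Measure.eqOn_Icc_of_ae_eq (μ := volume) hT.ne ?_ (by fun_prop) (by fun_prop)
      rw [← restrict_Ioo_eq_restrict_Icc]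
      refine (ae_restrict_iff' measurableSet_Ioo).2 ?_
      filter_upwards [hae] with t ht htT using (ht htT).1
    have h1 : EqOn (fun t => v (γ t, t)) (fun _ => (0 : ℝ)) (Icc 0 T) := by
      refine Measure.eqOn_Icc_of_ae_eq (μ := volume) hT.ne ?_ (by fun_prop) (by fun_prop)
      rw [← restrict_Ioo_eq_restrict_Icc]
      refine (ae_restrict_iff' measurableSet_Ioo).2 ?_
      filter_upwards [hae] with t ht htT using (ht htT).2
    exact fun t ht => ⟨h0 ht, h1 ht⟩
  · filter_upwards [h.initial.ae_eq hT hγ vc ((ae_restrict_iff' hU).1 vu),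
      h.initial_deriv.ae_eq hT hγ vtc ((ae_restrict_iff' hU).1 vtu)] with x h1 h2 using ⟨h1, h2⟩

/-! ### The modified energy -/

/-- The potential `|y| ^ (ρ + 2) / (ρ + 2)`. -/
noncomputable def potential (ρ y : ℝ) : ℝ := 1 / (ρ + 2) * |y| ^ (ρ + 2)

lemma hasDerivAt_potential {ρ : ℝ} (hρ : 0 < ρ) (y : ℝ) :
    HasDerivAt (potential ρ) (|y| ^ ρ * y) y := by
  have h2 : ρ + 2 ≠ 0 := by linarith
  have h3 : 1 / (ρ + 2) * ((ρ + 2) * |y| ^ (ρ + 2 - 2) * y) = |y| ^ ρ * y := by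
    rw [add_sub_cancel_right]
    field_simp
  rw [← h3]
  exact (hasDerivAt_abs_rpow y (by linarith : 1 < ρ + 2)).const_mul (1 / (ρ + 2))

lemma continuous_potential {ρ : ℝ} (hρ : 0 < ρ) : Continuous (potential ρ) :=
  continuous_iff_continuousAt.2 fun y => (hasDerivAt_potential hρ y).continuousAt

lemma continuous_abs_rpow_mul {ρ : ℝ} (hρ : 0 < ρ) : Continuous fun y : ℝ => |y| ^ ρ * y :=
  (continuous_abs.rpow_const fun _ => Or.inr hρ.le).mul continuous_id

lemma potential_nonneg {ρ : ℝ} (hρ : 0 < ρ) (y : ℝ) : 0 ≤ potential ρ y := by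
  unfold potential
  positivity

lemma potential_zero {ρ : ℝ} (hρ : 0 < ρ) : potential ρ 0 = 0 := by
  simp [potential, Real.zero_rpow (by linarith : ρ + 2 ≠ 0)]

/-- Homogeneity of the potential: the multiplier `ε u` yields `ρ + 2` times the potential, matching
`(ρ + 1) + 1` from the growth condition and the decay term. -/
lemma abs_rpow_mul_self {ρ : ℝ} (hρ : 0 < ρ) (y : ℝ) :
    |y| ^ ρ * y * y = (ρ + 2) * potential ρ y := by
  have h2 : ρ + 2 ≠ 0 := by linarith
  rw [potential, Real.rpow_add_of_nonneg (abs_nonneg y) hρ.le zero_le_two, Real.rpow_two, sq_abs]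
  field_simp

/-! ### Modified density, flux and dissipation -/

/-- The density of the energy perturbed by `ε (u, u_t)`. -/
noncomputable def modifiedDensity (a b ε ρ : ℝ) (β : ℝ → ℝ) (v vx vt : ℝ × ℝ → ℝ)
    (z : ℝ × ℝ) : ℝ :=
  1 / 2 * (vt z * vt z) + 1 / 2 * (vx z * vx z) + (b + ε * a) / 2 * (v z * v z) + ε * (v z * vt z)
    + β z.2 * potential ρ (v z)

/-- The time derivative of the modified density. -/
noncomputable def modifiedDensityDeriv (a b ε ρ : ℝ) (β : ℝ → ℝ) (v vx vt gtx gtt : ℝ × ℝ → ℝ)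
    (z : ℝ × ℝ) : ℝ :=
  vt z * gtt z + vx z * gtx z + (b + ε * a) * (v z * vt z) + ε * (vt z * vt z + v z * gtt z)
    + (potential ρ (v z) * deriv β z.2 + β z.2 * (|v z| ^ ρ * v z * vt z))

/-- The flux of the modified density. -/
noncomputable def modifiedFlux (ε : ℝ) (v vx vt : ℝ × ℝ → ℝ) (z : ℝ × ℝ) : ℝ :=
  vx z * vt z + ε * (v z * vx z)

/-- The space derivative of the flux. -/
noncomputable def modifiedFluxDeriv (ε : ℝ) (v vx vt gxx gtx : ℝ × ℝ → ℝ) (z : ℝ × ℝ) : ℝ :=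
  (vt z * gxx z + vx z * gtx z) + ε * (vx z * vx z + v z * gxx z)

/-- Smallness conditions on the perturbation parameter and the decay rate. -/
structure IsDecayRate (a b ε lam : ℝ) : Prop where
  pos : 0 < ε
  le_one : ε ≤ 1
  le_half : ε ≤ a / 2
  rate_pos : 0 < lam
  rate_le : lam ≤ ε
  rate_mul_le : lam * (a + b + 1) ≤ ε * b

/-- Pointwise dissipation of the modified energy. -/
lemma IsDecayRate.dissipation {a b ε lam ρ A P Q X Y Z B B' N W : ℝ} (h : IsDecayRate a b ε lam)
    (ha : 0 < a) (hb : 0 < b) (hN : N * A = (ρ + 2) * W) (hW : 0 ≤ W) (hB : 0 ≤ B)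
    (hρ : 0 < ρ) (hB' : B' ≤ lam * (ρ + 1) * B) (heq : Z - X + a * Q + b * A + B * N = 0) :
    Q * Z + P * Y + (b + ε * a) * (A * Q) + ε * (Q * Q + A * Z) + (W * B' + B * (N * Q))
      ≤ (Q * X + P * Y) + ε * (P * P + A * X)
        - lam * (1 / 2 * (Q * Q) + 1 / 2 * (P * P) + (b + ε * a) / 2 * (A * A) + ε * (A * Q)
          + B * W) := by
  obtain ⟨h0, h1, h2, h3, h4, h5⟩ := h
  have hZ : Z = X - a * Q - b * A - B * N := by linarith
  subst hZ
  -- The coefficient's growth costs `λ(ρ+1)BW` and the decay term `λBW`; their sum `λ(ρ+2)BW` is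
  -- paid by `ε(ρ+2)BW`.
  have e1 : W * B' ≤ W * (lam * (ρ + 1) * B) := mul_le_mul_of_nonneg_left hB' hW
  have e2 : B * W * lam * (ρ + 2) ≤ B * W * ε * (ρ + 2) :=
    mul_le_mul_of_nonneg_right (mul_le_mul_of_nonneg_left h4 (mul_nonneg hB hW)) (by linarith)
  have e3 : ε * B * (N * A) = ε * B * ((ρ + 2) * W) := by rw [hN]
  have e4 : 0 ≤ lam * ε * ((A - Q) * (A - Q)) :=
    mul_nonneg (mul_pos h3 h0).le (mul_self_nonneg _)
  -- The chain is `λ(1+ε)/2 ≤ λ ≤ ε ≤ a/2 ≤ a - ε`; the part `ε/2` comes from splitting `AQ` with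
  -- `e4`.
  have e5 : lam * (1 / 2 + ε / 2) * (Q * Q) ≤ (a - ε) * (Q * Q) := by
    refine mul_le_mul_of_nonneg_right ?_ (mul_self_nonneg Q)
    nlinarith
  have e6 : lam / 2 * (P * P) ≤ ε * (P * P) :=
    mul_le_mul_of_nonneg_right (by linarith) (mul_self_nonneg P)
  have e7 : lam * ((b + ε * a) / 2 + ε / 2) * (A * A) ≤ ε * b * (A * A) := by
    refine mul_le_mul_of_nonneg_right ?_ (mul_self_nonneg A)
    have e8 : (b + ε * a) / 2 + ε / 2 ≤ a + b + 1 := by nlinarith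
    exact (mul_le_mul_of_nonneg_left e8 h3.le).trans h5
  linarith

/-- The modified density controls the energy density. -/
lemma IsDecayRate.lower {a b ε lam A P Q V : ℝ} (h : IsDecayRate a b ε lam)
    (hV : 0 ≤ V) : min (1 / 2) b * (1 / 2 * Q ^ 2 + 1 / 2 * P ^ 2 + 1 / 2 * A ^ 2 + V) ≤
      1 / 2 * (Q * Q) + 1 / 2 * (P * P) + (b + ε * a) / 2 * (A * A) + ε * (A * Q) + V := by
  obtain ⟨h0, h1, h2, h3, h4, h5⟩ := h
  have m1 : min (1 / 2) b ≤ 1 / 2 := min_le_left _ _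
  have m2 : min (1 / 2) b ≤ b := min_le_right _ _
  have e1 : min (1 / 2) b * V ≤ 1 * V := mul_le_mul_of_nonneg_right (by linarith) hV
  have e2 : min (1 / 2) b * Q ^ 2 ≤ 1 / 2 * Q ^ 2 := mul_le_mul_of_nonneg_right m1 (sq_nonneg Q)
  have e3 : min (1 / 2) b * P ^ 2 ≤ 1 / 2 * P ^ 2 := mul_le_mul_of_nonneg_right m1 (sq_nonneg P)
  have e4 : min (1 / 2) b * A ^ 2 ≤ b * A ^ 2 := mul_le_mul_of_nonneg_right m2 (sq_nonneg A)
  -- Completing this square spends `¼Q²` and `ε²A² ≤ (εa/2)A²`, leaving `¼Q²`, `½P²` and `(b/2)A²`;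
  -- hence the constant `min (1/2) b`.
  have e5 : 0 ≤ (1 / 2 * Q + ε * A) ^ 2 := sq_nonneg _
  have e6 : ε * ε * A ^ 2 ≤ ε * (a / 2) * A ^ 2 :=
    mul_le_mul_of_nonneg_right (mul_le_mul_of_nonneg_left h2 h0.le) (sq_nonneg A)
  have e7 := sq_nonneg P
  nlinarith

/-- The energy density controls the modified density. -/
lemma IsDecayRate.upper {a b ε lam A P Q V : ℝ} (h : IsDecayRate a b ε lam) (ha : 0 < a)
    (hb : 0 < b) (hV : 0 ≤ V) :
      1 / 2 * (Q * Q) + 1 / 2 * (P * P) + (b + ε * a) / 2 * (A * A) + ε * (A * Q) + V ≤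
        (a + b + 2) * (1 / 2 * Q ^ 2 + 1 / 2 * P ^ 2 + 1 / 2 * A ^ 2 + V) := by
  obtain ⟨h0, h1, h2, h3, h4, h5⟩ := h
  have e1 : 0 ≤ ε * (A - Q) ^ 2 := by positivity
  have e2 : ε * Q ^ 2 ≤ 1 * Q ^ 2 := mul_le_mul_of_nonneg_right h1 (sq_nonneg Q)
  have e3 : ε * A ^ 2 ≤ 1 * A ^ 2 := mul_le_mul_of_nonneg_right h1 (sq_nonneg A)
  have e4 : ε * (a * A ^ 2) ≤ 1 * (a * A ^ 2) := mul_le_mul_of_nonneg_right h1 (by positivity)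
  have e5 : 0 ≤ (a + b) * Q ^ 2 := by positivity
  have e6 : 0 ≤ (a + b) * P ^ 2 := by positivity
  have e7 : 0 ≤ (a + b) * V := by positivity
  nlinarith [sq_nonneg P, sq_nonneg A]

/-! ### Energy inequality on rectangles -/

section

variable {a b ε lam ρ T : ℝ} {γ β : ℝ → ℝ} {K : ℝ≥0} {v vx vt gxx gtx gtt : ℝ × ℝ → ℝ}

lemma IsContinuousSolution.continuous_density
    (h : IsContinuousSolution a b ρ T γ β v vx vt gxx gtx gtt)
    (hρ : 0 < ρ) (hβ : Continuous β) : Continuous (modifiedDensity a b ε ρ β v vx vt) := by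
  have h1 := h.continuous
  have h2 := h.continuous_fst
  have h3 := h.continuous_snd
  have h4 := (continuous_potential hρ).comp h1
  have h5 := hβ.comp (_root_.continuous_snd (X := ℝ) (Y := ℝ))
  unfold modifiedDensity
  exact (by fun_prop : Continuous fun z => 1 / 2 * (vt z * vt z) + 1 / 2 * (vx z * vx z)
    + (b + ε * a) / 2 * (v z * v z) + ε * (v z * vt z)).add (h5.mul h4)

lemma IsContinuousSolution.continuous_flux
    (h : IsContinuousSolution a b ρ T γ β v vx vt gxx gtx gtt) :
    Continuous (modifiedFlux ε v vx vt) := by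
  have h1 := h.continuous
  have h2 := h.continuous_fst
  have h3 := h.continuous_snd
  unfold modifiedFlux
  fun_prop

/-- The product rule handles the quadratic terms; the potential uses the classical chain rule,
available because `vt` is continuous. -/
lemma IsContinuousSolution.isPrimitive_density
    (h : IsContinuousSolution a b ρ T γ β v vx vt gxx gtx gtt)
    (hρ : 0 < ρ) (hβ : LipschitzWith K β) {s : ℝ} (hs : 0 ≤ s) (hsT : s < T) :
    ∀ᵐ x : ℝ, x ∈ Ioo 0 (γ s) →
      IsPrimitive (fun t => modifiedDensity a b ε ρ β v vx vt (x, t))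
        (fun t => modifiedDensityDeriv a b ε ρ β v vx vt gtx gtt (x, t)) s T := by
  filter_upwards [h.line_snd s hs hsT] with x hx hxI
  obtain ⟨h1, h2, h3⟩ := hx hxI
  have hc : Continuous fun t => vt (x, t) := h.continuous_snd.comp (by fun_prop)
  have h4 := h1.comp hc (hasDerivAt_potential hρ) (continuous_abs_rpow_mul hρ) hsT.le
  have h5 := (((((h3.mul hsT.le h3).const_mul (1 / 2)).add
    ((h2.mul hsT.le h2).const_mul (1 / 2))).add
    ((h1.mul hsT.le h1).const_mul ((b + ε * a) / 2))).add ((h1.mul hsT.le h3).const_mul ε)).add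
    ((hβ.isPrimitive_deriv s T).mul hsT.le h4)
  refine h5.congr_ae hsT.le (Eventually.of_forall fun t _ => ?_)
  simp only [modifiedDensityDeriv]
  ring

lemma IsContinuousSolution.isPrimitive_flux
    (h : IsContinuousSolution a b ρ T γ β v vx vt gxx gtx gtt)
    (hγ : IsExpanding γ) :
    ∀ᵐ t : ℝ, t ∈ Ioo 0 T → IsPrimitive (fun x => modifiedFlux ε v vx vt (x, t))
        (fun x => modifiedFluxDeriv ε v vx vt gxx gtx (x, t)) 0 (γ t) := by
  filter_upwards [h.line_fst] with t ht htT
  obtain ⟨h1, h2, h3⟩ := ht htT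
  have hp := (hγ.pos t).le
  have h5 := (h2.mul hp h3).add ((h1.mul hp h2).const_mul ε)
  refine h5.congr_ae hp (Eventually.of_forall fun t _ => ?_)
  simp only [modifiedFluxDeriv]
  ring

/-- The energy inequality on a rectangle contained in the moving domain. -/
theorem IsContinuousSolution.rectangle_inequality
    (h : IsContinuousSolution a b ρ T γ β v vx vt gxx gtx gtt) (hγ : IsExpanding γ) (ha : 0 < a)
    (hb : 0 < b) (hρ : 0 < ρ) (hβ : LipschitzWith K β) (hβ0 : ∀ t, 0 ≤ β t)
    (hgrowth : ∀ᵐ t : ℝ, t ∈ Ioo 0 T → deriv β t ≤ lam * (ρ + 1) * β t)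
    (hd : IsDecayRate a b ε lam) {s r : ℝ} (hs : 0 ≤ s) (hsr : s ≤ r) (hrT : r ≤ T) (hsT : s < T) :
    ∫ x in (0 : ℝ)..γ s,
        (modifiedDensity a b ε ρ β v vx vt (x, r) - modifiedDensity a b ε ρ β v vx vt (x, s)) ≤
      (∫ τ in s..r, (modifiedFlux ε v vx vt (γ s, τ) - modifiedFlux ε v vx vt (0, τ)))
        - lam * ∫ τ in s..r, ∫ x in (0 : ℝ)..γ s, modifiedDensity a b ε ρ β v vx vt (x, τ) := by
  set R : Set (ℝ × ℝ) := Ioo 0 (γ s) ×ˢ Ioo s r with hR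
  have hRm : MeasurableSet R := measurableSet_Ioo.prod measurableSet_Ioo
  have hRU : R ⊆ movingDomain T γ := fun z hz => ⟨⟨hs.trans_lt hz.2.1, hz.2.2.trans_le hrT⟩,
    hz.1.1, hz.1.2.trans_le (hγ.monotone hz.2.1.le)⟩
  set L : Set (ℝ × ℝ) := Icc 0 (γ s) ×ˢ Icc s r with hL
  have hLc : IsCompact L := isCompact_Icc.prod isCompact_Icc
  have hRL : R ⊆ L := prod_mono Ioo_subset_Icc_self Ioo_subset_Icc_self
  -- The terms of `Dt` and `qx` containing second derivatives or `β'` are integrable functions times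
  -- continuous ones, and the latter are bounded on the compact `L`.
  have hI : ∀ {g w : ℝ × ℝ → ℝ}, IntegrableOn g L → Continuous w →
      IntegrableOn (fun z => w z * g z) L := fun hg hw => hg.continuousOn_mul hw.continuousOn hLc
  have hC : ∀ {w : ℝ × ℝ → ℝ}, Continuous w → IntegrableOn w L := fun hw =>
    hw.continuousOn.integrableOn_compact hLc
  have c1 := h.continuous
  have c2 := h.continuous_fst
  have c3 := h.continuous_snd
  have c4 := (continuous_potential hρ).comp c1
  have c5 := hβ.continuous.comp (_root_.continuous_snd (X := ℝ) (Y := ℝ))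
  have c6 := (continuous_abs_rpow_mul hρ).comp c1
  have ixx := h.integrable_xx.integrableOn (s := L)
  have itx := h.integrable_tx.integrableOn (s := L)
  have itt := h.integrable_tt.integrableOn (s := L)
  have iβ : IntegrableOn (fun z : ℝ × ℝ => deriv β z.2) L := by
    refine Measure.integrableOn_of_bounded (M := K) hLc.measure_lt_top.ne
      ((measurable_deriv β).comp measurable_snd).aestronglyMeasurable ?_
    exact Eventually.of_forall fun z => norm_deriv_le_of_lipschitz hβ
  set D := modifiedDensity a b ε ρ β v vx vt with hDdef
  set Dt := modifiedDensityDeriv a b ε ρ β v vx vt gtx gtt with hDt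
  set q := modifiedFlux ε v vx vt with hq
  set qx := modifiedFluxDeriv ε v vx vt gxx gtx with hqx
  have iD : IntegrableOn D R := (hC (h.continuous_density hρ hβ.continuous)).mono_set hRL
  have iDt : IntegrableOn Dt R := by
    refine IntegrableOn.mono_set ?_ hRL
    exact ((((hI itt c3).add (hI itx c2)).add (hC (by fun_prop))).add
      (((hC (c3.mul c3)).add (hI itt c1)).const_mul ε)).add
      ((hI iβ c4).add (hC (c5.mul (c6.mul c3))))
  have iqx : IntegrableOn qx R := by
    refine IntegrableOn.mono_set ?_ hRL
    exact ((hI ixx c3).add (hI itx c2)).add (((hC (c2.mul c2)).add (hI ixx c1)).const_mul ε)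
  have hineq : ∫ z in R, Dt z ≤ ∫ z in R, (qx z - lam * D z) := by
    refine setIntegral_mono_on_ae iDt (iqx.sub (iD.const_mul lam)) hRm ?_
    have hg : ∀ᵐ z : ℝ × ℝ, z.2 ∈ Ioo 0 T → deriv β z.2 ≤ lam * (ρ + 1) * β z.2 :=
      Measure.quasiMeasurePreserving_snd.ae hgrowth
    filter_upwards [h.equation, hg] with z h1 h2 hz
    have hzU := hRU hz
    exact hd.dissipation ha hb (abs_rpow_mul_self hρ (v z)) (potential_nonneg hρ _) (hβ0 _) hρ
      (h2 hzU.1) (h1 hzU)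
  have hleft : ∫ z in R, Dt z = ∫ x in (0 : ℝ)..γ s, (D (x, r) - D (x, s)) := by
    have h1 := setIntegral_prod (μ := (volume : Measure ℝ)) (ν := (volume : Measure ℝ)) Dt iDt
    rw [intervalIntegral.integral_of_le (hγ.pos s).le, integral_Ioc_eq_integral_Ioo]
    refine h1.trans (setIntegral_congr_ae measurableSet_Ioo ?_)
    filter_upwards [h.isPrimitive_density (ε := ε) hρ hβ hs hsT] with x hx hxI
    rw [← ((hx hxI).mono hsr hrT).integral_eq_sub hsr, intervalIntegral.integral_of_le hsr,
      integral_Ioc_eq_integral_Ioo]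
  have hswap : ∀ F : ℝ × ℝ → ℝ, IntegrableOn F R →
      ∫ z in R, F z = ∫ τ in s..r, ∫ x in (0 : ℝ)..γ s, F (x, τ) := by
    intro F hF
    have h1 : Integrable F ((volume.restrict (Ioo 0 (γ s))).prod (volume.restrict (Ioo s r))) := by
      rw [Measure.prod_restrict]
      exact hF
    have h2 := integral_prod_symm F h1
    rw [Measure.prod_restrict] at h2
    rw [intervalIntegral.integral_of_le hsr, integral_Ioc_eq_integral_Ioo]
    simp_rw [intervalIntegral.integral_of_le (hγ.pos s).le, integral_Ioc_eq_integral_Ioo]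
    exact h2
  have hright : ∫ z in R, qx z = ∫ τ in s..r, (q (γ s, τ) - q (0, τ)) := by
    rw [hswap qx iqx]
    refine intervalIntegral.integral_congr_ae ?_
    filter_upwards [h.isPrimitive_flux (ε := ε) hγ, Measure.ae_ne volume T] with τ hτ hτT hτI
    rw [uIoc_of_le hsr] at hτI
    have hτ0 : τ ∈ Ioo 0 T :=
      ⟨hs.trans_lt hτI.1, lt_of_le_of_ne (hτI.2.trans hrT) hτT⟩
    exact ((hτ hτ0).mono (hγ.pos s).le (hγ.monotone hτI.1.le)).integral_eq_sub (hγ.pos s).le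
  rw [← hleft, ← hright, ← hswap D iD]
  refine hineq.trans_eq ?_
  rw [integral_sub iqx (iD.const_mul lam), integral_const_mul]

end

/-! ### Decay of the modified energy -/

/-- The derivative, at the initial time, of the integral over the region swept by a moving point. -/
lemma hasDerivWithinAt_integral_swept {G : ℝ × ℝ → ℝ} (hG : Continuous G) {σ : ℝ → ℝ}
    (hσ : Continuous σ) {σ' s : ℝ} (hd : HasDerivWithinAt σ σ' (Ici s) s) :
    HasDerivWithinAt (fun t => ∫ x in σ s..σ t, G (x, t)) (σ' * G (σ s, s)) (Ici s) s := by
  -- Rescaling to `θ ∈ [0, 1]` writes the integral as `(σ t - σ s) * m t` with `m` continuous, so no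
  -- differentiability of `G` is needed.
  set m : ℝ → ℝ := fun t => ∫ θ in (0 : ℝ)..1, G (σ s + (σ t - σ s) * θ, t) with hm
  have hmc : Continuous m := by
    refine intervalIntegral.continuous_parametric_intervalIntegral_of_continuous' ?_ 0 1
    exact hG.comp (by fun_prop : Continuous fun z : ℝ × ℝ =>
      (σ s + (σ z.1 - σ s) * z.2, z.1))
  have hms : m s = G (σ s, s) := by simp [hm]
  have hf : ∀ t, ∫ x in σ s..σ t, G (x, t) = (σ t - σ s) * m t := by
    intro t
    have := intervalIntegral.smul_integral_comp_add_mul (fun x => G (x, t)) (σ t - σ s) (σ s)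
      (a := 0) (b := 1)
    simp only [mul_zero, add_zero, mul_one, add_sub_cancel] at this
    rw [← this, smul_eq_mul]
  simp_rw [hf]
  rw [hasDerivWithinAt_iff_tendsto_slope] at hd ⊢
  have h1 := hd.mul ((hmc.tendsto s).mono_left (nhdsWithin_le_nhds (s := Ici s \ {s})))
  rw [hms] at h1
  refine h1.congr fun t => ?_
  simp only [slope_def_field, sub_self, zero_mul, sub_zero]
  ring

section

variable {a b ε lam ρ T : ℝ} {γ β : ℝ → ℝ} {K : ℝ≥0} {v vx vt gxx gtx gtt : ℝ × ℝ → ℝ}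

/-- Both sides are continuous in `x`, so the almost everywhere identity holds at every point,
including the boundary, where it is needed. -/
lemma IsContinuousSolution.sub_eq_integral_snd
    (h : IsContinuousSolution a b ρ T γ β v vx vt gxx gtx gtt) (hγ : IsExpanding γ) {s t x : ℝ}
    (hs : 0 ≤ s) (hsT : s < T) (ht : t ∈ Icc s T) (hx : x ∈ Icc 0 (γ s)) :
    v (x, t) - v (x, s) = ∫ τ in s..t, vt (x, τ) := by
  have c1 := h.continuous
  have c3 := h.continuous_snd
  have hc : Continuous fun x => ∫ τ in s..t, vt (x, τ) :=
    intervalIntegral.continuous_parametric_intervalIntegral_of_continuous'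
      (f := fun x τ => vt (x, τ)) (by fun_prop) s t
  refine Measure.eqOn_Icc_of_ae_eq (μ := volume) (f := fun x => v (x, t) - v (x, s))
    (hγ.pos s).ne ?_ (by fun_prop) hc.continuousOn hx
  rw [← restrict_Ioo_eq_restrict_Icc]
  refine (ae_restrict_iff' measurableSet_Ioo).2 ?_
  filter_upwards [h.line_snd s hs hsT] with x hx hxI
  exact (((hx hxI).1.mono ht.1 ht.2).integral_eq_sub ht.1).symm

lemma IsContinuousSolution.eq_integral_fst
    (h : IsContinuousSolution a b ρ T γ β v vx vt gxx gtx gtt) (hγ : IsExpanding γ) {t x : ℝ}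
    (hT : 0 < T) (ht : t ∈ Icc 0 T) (hx : x ∈ Icc 0 (γ t)) :
    v (x, t) = v (0, t) + ∫ y in (0 : ℝ)..x, vx (y, t) := by
  have c1 := h.continuous
  have c2 := h.continuous_fst
  -- Truncation keeps the abscissa in the slice at the other times, where `x` may lie outside.
  have hσ : Continuous fun t => min x (γ t) := continuous_const.min hγ.continuous
  have hc : Continuous fun t => ∫ y in (0 : ℝ)..min x (γ t), vx (y, t) :=
    intervalIntegral.continuous_parametric_intervalIntegral_of_continuous
      (f := fun t y => vx (y, t)) (by fun_prop) hσ
  have key : EqOn (fun t => v (min x (γ t), t))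
      (fun t => v (0, t) + ∫ y in (0 : ℝ)..min x (γ t), vx (y, t)) (Icc 0 T) := by
    refine Measure.eqOn_Icc_of_ae_eq (μ := volume) hT.ne ?_ (by fun_prop) (by fun_prop)
    rw [← restrict_Ioo_eq_restrict_Icc]
    refine (ae_restrict_iff' measurableSet_Ioo).2 ?_
    filter_upwards [h.line_fst] with t ht htT
    exact (ht htT).1.eq_integral _ ⟨le_min hx.1 (hγ.pos t).le, min_le_right _ _⟩
  have := key ht
  simp only [min_eq_left hx.2] at this
  exact this

/-- The time derivative vanishes on the fixed boundary. -/
lemma IsContinuousSolution.snd_zero (h : IsContinuousSolution a b ρ T γ β v vx vt gxx gtx gtt)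
    (hγ : IsExpanding γ) {s : ℝ} (hs : s ∈ Ico 0 T) : vt (0, s) = 0 := by
  have c3 : Continuous fun τ => vt (0, τ) := h.continuous_snd.comp (by fun_prop)
  have h1 : HasDerivWithinAt (fun t => ∫ τ in s..t, vt (0, τ)) (vt (0, s)) (Ici s) s :=
    (intervalIntegral.integral_hasDerivAt_right (c3.intervalIntegrable _ _)
      c3.stronglyMeasurable.stronglyMeasurableAtFilter c3.continuousAt).hasDerivWithinAt
  have h2 : (fun t => ∫ τ in s..t, vt (0, τ)) =ᶠ[𝓝[≥] s] fun _ => (0 : ℝ) := by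
    filter_upwards [Icc_mem_nhdsGE hs.2] with t ht
    rw [← h.sub_eq_integral_snd hγ hs.1 hs.2 ht (left_mem_Icc.2 (hγ.pos s).le),
      (h.boundary t ⟨hs.1.trans ht.1, ht.2⟩).1, (h.boundary s ⟨hs.1, hs.2.le⟩).1, sub_zero]
  have h3 : HasDerivWithinAt (fun _ : ℝ => (0 : ℝ)) (vt (0, s)) (Ici s) s :=
    h1.congr_of_eventuallyEq h2.symm (by simp)
  exact (uniqueDiffWithinAt_Ici s).eq_deriv _ h3 (hasDerivWithinAt_const s (Ici s) (0 : ℝ))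

/-- The tangential derivative vanishes on the moving boundary. -/
lemma IsContinuousSolution.tangential_eq_zero
    (h : IsContinuousSolution a b ρ T γ β v vx vt gxx gtx gtt) (hγ : IsExpanding γ) {s γ' : ℝ}
    (hs : s ∈ Ico 0 T) (hd : HasDerivWithinAt γ γ' (Ici s) s) :
    vt (γ s, s) + γ' * vx (γ s, s) = 0 := by
  have c3 : Continuous fun τ => vt (γ s, τ) := h.continuous_snd.comp (by fun_prop)
  have h1 : HasDerivWithinAt (fun t => ∫ τ in s..t, vt (γ s, τ)) (vt (γ s, s)) (Ici s) s :=
    (intervalIntegral.integral_hasDerivAt_right (c3.intervalIntegrable _ _)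
      c3.stronglyMeasurable.stronglyMeasurableAtFilter c3.continuousAt).hasDerivWithinAt
  have h2 := h1.add (hasDerivWithinAt_integral_swept h.continuous_fst hγ.continuous hd)
  -- Going up from `(γ s, s)` to `(γ s, t)` and across to `(γ t, t)` joins two zeros of `v`.
  -- Differentiating at `t = s` gives the claim.
  have h3 : (fun t => (∫ τ in s..t, vt (γ s, τ)) + ∫ x in γ s..γ t, vx (x, t)) =ᶠ[𝓝[≥] s]
      fun _ => (0 : ℝ) := by
    filter_upwards [Icc_mem_nhdsGE hs.2] with t ht
    have ht0 : t ∈ Icc 0 T := ⟨hs.1.trans ht.1, ht.2⟩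
    have hT : 0 < T := hs.1.trans_lt hs.2
    have c2 : Continuous fun x => vx (x, t) := h.continuous_fst.comp (by fun_prop)
    have e1 := h.eq_integral_fst hγ hT ht0 ⟨(hγ.pos s).le, hγ.monotone ht.1⟩
    have e2 := h.eq_integral_fst hγ hT ht0 (right_mem_Icc.2 (hγ.pos t).le)
    have e3 := h.sub_eq_integral_snd hγ hs.1 hs.2 ht (right_mem_Icc.2 (hγ.pos s).le)
    have e4 := intervalIntegral.integral_interval_sub_left
      (c2.intervalIntegrable (μ := volume) 0 (γ t))
      (c2.intervalIntegrable (μ := volume) 0 (γ s))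
    rw [(h.boundary t ht0).2] at e2
    rw [(h.boundary s ⟨hs.1, hs.2.le⟩).2] at e3
    linarith
  have h4 : HasDerivWithinAt (fun _ : ℝ => (0 : ℝ)) (vt (γ s, s) + γ' * vx (γ s, s)) (Ici s) s :=
    h2.congr_of_eventuallyEq h3.symm (by simp)
  exact (uniqueDiffWithinAt_Ici s).eq_deriv _ h4 (hasDerivWithinAt_const s (Ici s) (0 : ℝ))

/-- **Decay of the modified energy.** -/
theorem IsContinuousSolution.modified_energy_le
    (h : IsContinuousSolution a b ρ T γ β v vx vt gxx gtx gtt) (hγ : IsExpanding γ) (ha : 0 < a)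
    (hb : 0 < b) (hρ : 0 < ρ) (hβ : LipschitzWith K β) (hβ0 : ∀ t, 0 ≤ β t)
    (hgrowth : ∀ᵐ t : ℝ, t ∈ Ioo 0 T → deriv β t ≤ lam * (ρ + 1) * β t)
    (hd : IsDecayRate a b ε lam)
    (hγd : ∀ s ∈ Ico 0 T, ∃ γ', 0 ≤ γ' ∧ γ' ≤ 1 ∧ HasDerivWithinAt γ γ' (Ici s) s)
    {t : ℝ} (ht : t ∈ Icc 0 T) :
    ∫ x in (0 : ℝ)..γ t, modifiedDensity a b ε ρ β v vx vt (x, t) ≤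
      (∫ x in (0 : ℝ)..γ 0, modifiedDensity a b ε ρ β v vx vt (x, 0)) * Real.exp (-(lam * t)) := by
  set D := modifiedDensity a b ε ρ β v vx vt with hD
  set q := modifiedFlux ε v vx vt with hq
  have hDc : Continuous D := h.continuous_density hρ hβ.continuous
  have hqc : Continuous q := h.continuous_flux
  set E : ℝ → ℝ := fun t => ∫ x in (0 : ℝ)..γ t, D (x, t) with hE
  have hEc : Continuous E :=
    intervalIntegral.continuous_parametric_intervalIntegral_of_continuous
      (f := fun t y => D (y, t)) (by fun_prop) hγ.continuous
  have hslice : ∀ t, Continuous fun x => D (x, t) := fun t => hDc.comp (by fun_prop)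
  have key : ∀ s ∈ Ico 0 T, ∀ r, -lam * E s < r →
      ∃ᶠ z in 𝓝[>] s, (z - s)⁻¹ * (E z - E s) < r := by
    intro s hs r hr
    obtain ⟨γ', h0, h1, hγ'⟩ := hγd s hs
    -- `N` bounds the increment of `E`: the rectangle over the fixed slice `(0, γ s)`, plus the
    -- strip swept by the boundary.
    set N : ℝ → ℝ := fun t => ((∫ τ in s..t, (q (γ s, τ) - q (0, τ)))
      - lam * ∫ τ in s..t, ∫ x in (0 : ℝ)..γ s, D (x, τ)) + ∫ x in γ s..γ t, D (x, t) with hN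
    have prim : ∀ {F : ℝ → ℝ}, Continuous F →
        HasDerivWithinAt (fun t => ∫ τ in s..t, F τ) (F s) (Ici s) s := fun hF =>
      (intervalIntegral.integral_hasDerivAt_right (hF.intervalIntegrable _ _)
        hF.stronglyMeasurable.stronglyMeasurableAtFilter hF.continuousAt).hasDerivWithinAt
    have hcq : Continuous fun τ => q (γ s, τ) - q (0, τ) := by fun_prop
    have hcD : Continuous fun τ => ∫ x in (0 : ℝ)..γ s, D (x, τ) :=
      intervalIntegral.continuous_parametric_intervalIntegral_of_continuous'
        (f := fun t y => D (y, t)) (by fun_prop) 0 (γ s)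
    have hNd := ((prim hcq).sub ((prim hcD).const_mul lam)).add
      (hasDerivWithinAt_integral_swept hDc hγ.continuous hγ')
    -- With `v = 0` and `vt = -γ' vx`, the flux is `-γ' vx²` and the density `½(1 + γ'²) vx²`; the
    -- sum is `-½γ'(1 - γ'²) vx²`.
    have hbd : q (γ s, s) - q (0, s) + γ' * D (γ s, s) ≤ 0 := by
      have hb1 := h.boundary s ⟨hs.1, hs.2.le⟩
      have e1 := h.tangential_eq_zero hγ hs hγ'
      have e2 := h.snd_zero hγ hs
      have e3 : vt (γ s, s) = -(γ' * vx (γ s, s)) := by linarith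
      simp only [hq, hD, modifiedFlux, modifiedDensity, hb1.1, hb1.2, e2, e3, potential_zero hρ]
      have e4 : 0 ≤ γ' * (1 - γ' * γ') * (vx (γ s, s) * vx (γ s, s)) := by
        refine mul_nonneg (mul_nonneg h0 ?_) (mul_self_nonneg _)
        nlinarith
      linarith
    have hN' : (q (γ s, s) - q (0, s) - lam * E s) + γ' * D (γ s, s) < r := by linarith
    have hev := (hasDerivWithinAt_iff_tendsto_slope.1 hNd).eventually (gt_mem_nhds hN')
    rw [Ici_sdiff_left] at hev
    refine Eventually.frequently ?_
    filter_upwards [hev, Ioc_mem_nhdsGT hs.2] with z hz hzI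
    have hrect := h.rectangle_inequality (ε := ε) hγ ha hb hρ hβ hβ0 hgrowth hd hs.1 hzI.1.le
      hzI.2 hs.2
    rw [intervalIntegral.integral_sub ((hslice z).intervalIntegrable _ _)
      ((hslice s).intervalIntegrable _ _)] at hrect
    have hsplit : (∫ x in (0 : ℝ)..γ s, D (x, z)) + ∫ x in γ s..γ z, D (x, z) = E z :=
      intervalIntegral.integral_add_adjacent_intervals ((hslice z).intervalIntegrable _ _)
        ((hslice z).intervalIntegrable _ _)
    have hle : E z - E s ≤ N z - N s := by
      have hNs : N s = 0 := by simp [hN]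
      rw [hNs, ← hsplit]
      simp only [hN, hE]
      linarith
    refine lt_of_le_of_lt ?_ hz
    rw [slope_def_field, div_eq_inv_mul]
    exact mul_le_mul_of_nonneg_left hle (inv_nonneg.2 (sub_nonneg.2 hzI.1.le))
  -- Only right difference quotients are controlled; `E` need not be differentiable.
  have := le_gronwallBound_of_liminf_deriv_right_le (f' := fun s => -lam * E s) (K := -lam)
    (ε := 0)
    hEc.continuousOn key le_rfl (fun s _ => by simp) t ht
  rwa [gronwallBound_ε0, sub_zero, neg_mul] at this

end

/-! ### Moving boundaries and admissible coefficients -/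

section

variable {T : ℝ} {α γ β β' : ℝ → ℝ}

lemma movingDomain_congr (h : EqOn α γ (Icc 0 T)) : movingDomain T α = movingDomain T γ := by
  ext z
  refine and_congr_right fun hz => ?_
  rw [h (Ioo_subset_Icc_self hz)]

lemma MemLinftyL2.congr {f : ℝ × ℝ → ℝ} (hf : MemLinftyL2 T α f) (h : EqOn α γ (Icc 0 T)) :
    MemLinftyL2 T γ f where
  aestronglyMeasurable := movingDomain_congr h ▸ hf.aestronglyMeasurable
  bound := by
    obtain ⟨M, hM⟩ := hf.bound
    refine ⟨M, ?_⟩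
    filter_upwards [hM, ae_restrict_mem measurableSet_Ioo] with t ht htI
    rwa [← h (Ioo_subset_Icc_self htI)]

/-- Only values on `[0, T]` matter, so `α` and `β` may be replaced by their constant extensions,
which are globally monotone and globally Lipschitz. -/
lemma IsStrongSolution.congr {a b ρ : ℝ} {u₀ u₁ : ℝ → ℝ} {u ux ut uxx utx utt : ℝ × ℝ → ℝ}
    (h : IsStrongSolution a b ρ T α β u₀ u₁ u ux ut uxx utx utt) (hα : EqOn α γ (Icc 0 T))
    (hβ : EqOn β β' (Icc 0 T)) :
    IsStrongSolution a b ρ T γ β' u₀ u₁ u ux ut uxx utx utt where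
  weak_ux := movingDomain_congr hα ▸ h.weak_ux
  weak_ut := movingDomain_congr hα ▸ h.weak_ut
  weak_uxx := movingDomain_congr hα ▸ h.weak_uxx
  weak_utx := movingDomain_congr hα ▸ h.weak_utx
  weak_utt := movingDomain_congr hα ▸ h.weak_utt
  mem_u := h.mem_u.congr hα
  mem_ux := h.mem_ux.congr hα
  mem_uxx := h.mem_uxx.congr hα
  mem_ut := h.mem_ut.congr hα
  mem_utx := h.mem_utx.congr hα
  mem_utt := h.mem_utt.congr hα
  boundary := by
    filter_upwards [h.boundary, ae_restrict_mem measurableSet_Ioo] with t ht htI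
    rwa [← hα (Ioo_subset_Icc_self htI)]
  equation := by
    have hm : MeasurableSet {z : ℝ × ℝ | z.2 ∈ Ioo 0 T} := measurable_snd measurableSet_Ioo
    have h1 : ∀ᵐ z ∂(volume.restrict (movingDomain T γ)), z.2 ∈ Ioo 0 T :=
      ae_restrict_of_ae_restrict_of_subset (fun z hz => hz.1) (ae_restrict_mem hm)
    filter_upwards [movingDomain_congr hα ▸ h.equation, h1] with z hz hzI
    rwa [← hβ (Ioo_subset_Icc_self hzI)]
  initial := h.initial
  initial_deriv := h.initial_deriv

lemma IsMovingBoundary.isExpanding (hT : 0 ≤ T) (h : IsMovingBoundary T α) :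
    IsExpanding (IccExtend hT (Icc 0 T |>.domRestrict α)) := by
  have hmono : MonotoneOn α (Icc 0 T) := by
    refine monotoneOn_of_deriv_nonneg (convex_Icc 0 T) h.contDiffOn.continuousOn ?_ ?_
    · exact (h.contDiffOn.differentiableOn two_ne_zero).mono interior_subset
    · intro t ht
      rw [← derivWithin_of_mem_nhds (mem_interior_iff_mem_nhds.1 ht)]
      exact h.deriv_nonneg t (interior_subset ht)
  refine ⟨h.contDiffOn.continuousOn.domRestrict.Icc_extend', ?_, fun t => ?_⟩
  · exact Monotone.IccExtend (f := (Icc 0 T).domRestrict α) hT fun x y hxy => hmono x.2 y.2 hxy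
  · have h0 : (0 : ℝ) ∈ Icc 0 T := left_mem_Icc.2 hT
    have := hmono h0 (projIcc 0 T hT t).2 (projIcc 0 T hT t).2.1
    rwa [h.zero] at this

lemma eqOn_IccExtend_restrict (hT : 0 ≤ T) (f : ℝ → ℝ) :
    EqOn f (IccExtend hT ((Icc 0 T).domRestrict f)) (Icc 0 T) := fun t ht => by
  rw [IccExtend_of_mem _ _ ht, domRestrict_apply]

/-- The energy estimate needs just the right derivative of the boundary on `[0, T)`, with values in
`[0, 1]`; this survives the constant extension. -/
lemma IsMovingBoundary.hasDerivWithinAt (hT : 0 ≤ T) (h : IsMovingBoundary T α) {s : ℝ}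
    (hs : s ∈ Ico 0 T) : ∃ γ', 0 ≤ γ' ∧ γ' ≤ 1 ∧
      HasDerivWithinAt (IccExtend hT (Icc 0 T |>.domRestrict α)) γ' (Ici s) s := by
  have hsI : s ∈ Icc 0 T := Ico_subset_Icc_self hs
  obtain ⟨k, hk, hkd⟩ := h.deriv_le
  refine ⟨derivWithin α (Icc 0 T) s, h.deriv_nonneg s hsI, (hkd s hsI).trans hk.le, ?_⟩
  have h1 := (h.contDiffOn.differentiableOn two_ne_zero s hsI).hasDerivWithinAt
  have h2 := h1.congr (fun t ht => (eqOn_IccExtend_restrict hT α ht).symm)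
    (eqOn_IccExtend_restrict hT α hsI).symm
  refine h2.mono_of_mem_nhdsWithin ?_
  exact mem_of_superset (Icc_mem_nhdsGE hs.2) (Icc_subset_Icc_left hs.1)

lemma LipschitzOnWith.IccExtend_restrict {K : ℝ≥0} (hT : 0 ≤ T)
    (h : LipschitzOnWith K β (Icc 0 T)) :
    LipschitzWith K (IccExtend hT ((Icc 0 T).domRestrict β)) := by
  have := h.to_restrict.comp (LipschitzWith.projIcc hT)
  rwa [mul_one] at this

end

/-! ### Examples of admissible coefficients -/

lemma IsAdmissibleCoefficient.of_hasDerivAt {lam ρ T : ℝ} {β β' : ℝ → ℝ}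
    (hd : ∀ t, HasDerivAt β (β' t) t) (hc : Continuous β') (h0 : ∀ t ∈ Icc 0 T, 0 ≤ β t)
    (hle : ∀ t ∈ Icc 0 T, β' t ≤ lam * (ρ + 1) * β t) : IsAdmissibleCoefficient lam ρ T β where
  lipschitz := by
    have h1 : ContDiff ℝ 1 β := contDiff_one_iff_deriv.2
      ⟨fun t => (hd t).differentiableAt, by rwa [deriv_eq hd]⟩
    exact h1.contDiffOn.exists_lipschitzOnWith one_ne_zero (convex_Icc 0 T) isCompact_Icc
  nonneg := h0
  growth := by
    filter_upwards [ae_restrict_mem measurableSet_Ioo] with t ht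
    rw [(hd t).deriv]
    exact hle t (Ioo_subset_Icc_self ht)

lemma isAdmissibleCoefficient_exp {lam ρ T μ : ℝ} (hμ : μ ≤ lam * (ρ + 1)) :
    IsAdmissibleCoefficient lam ρ T (fun t => Real.exp (μ * t)) := by
  refine .of_hasDerivAt (β' := fun t => Real.exp (μ * t) * μ) (fun t => ?_) (by fun_prop)
    (fun t _ => (Real.exp_pos _).le) fun t _ => ?_
  · simpa using ((hasDerivAt_id t).const_mul μ).exp
  · rw [mul_comm]
    exact mul_le_mul_of_nonneg_right hμ (Real.exp_pos _).le

lemma exists_polynomial_isAdmissibleCoefficient {lam ρ : ℝ} (hlam : 0 < lam) (hρ : 0 < ρ) (n : ℕ) :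
    ∃ p : Polynomial ℝ, p.natDegree = n ∧ (∀ i ≤ n, 0 < p.coeff i) ∧
      ∀ T : ℝ, 0 < T → IsAdmissibleCoefficient lam ρ T (fun t => p.eval t) := by
  have hk : 0 < lam * (ρ + 1) := by positivity
  -- For `β = (t + m)^n` one has `β'/β = n/(t + m) ≤ n/m ≤ λ(ρ+1)` when `t ≥ 0`. The added 1 keeps
  -- `m`, hence all coefficients, positive when `n = 0`.
  set m : ℝ := n / (lam * (ρ + 1)) + 1 with hm
  have hm0 : 0 < m := by positivity
  refine ⟨(Polynomial.X + Polynomial.C m) ^ n, by simp, fun i hi => ?_, fun T _ => ?_⟩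
  · rw [Polynomial.coeff_X_add_C_pow]
    have := Nat.choose_pos hi
    positivity
  · simp only [Polynomial.eval_pow, Polynomial.eval_add, Polynomial.eval_X, Polynomial.eval_C]
    refine .of_hasDerivAt (β' := fun t => n * (t + m) ^ (n - 1)) (fun t => ?_) (by fun_prop)
      (fun t ht => pow_nonneg (by linarith [ht.1]) _) fun t ht => ?_
    · simpa using ((hasDerivAt_id t).add_const m).fun_pow n
    · rcases n with _ | n
      · simp only [Nat.cast_zero, zero_mul, pow_zero, mul_one]
        exact hk.le
      · have htm : 0 ≤ t + m := by linarith [ht.1]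
        have h1 : ((n + 1 : ℕ) : ℝ) ≤ lam * (ρ + 1) * (t + m) := by
          have h2 : lam * (ρ + 1) * m = ((n + 1 : ℕ) : ℝ) + lam * (ρ + 1) := by
            rw [hm]
            field_simp
          have h3 : 0 ≤ lam * (ρ + 1) * t := mul_nonneg hk.le ht.1
          rw [mul_add]
          linarith
        rw [Nat.add_sub_cancel, pow_succ']
        calc _ ≤ lam * (ρ + 1) * (t + m) * (t + m) ^ n :=
              mul_le_mul_of_nonneg_right h1 (pow_nonneg htm _)
          _ = _ := by ring

/-! ### Decay of the energy -/

/-- The energy of a continuous solution decays exponentially. -/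
theorem IsContinuousSolution.energy_le {a b ε lam ρ T : ℝ} {γ β : ℝ → ℝ} {K : ℝ≥0}
    {v vx vt gxx gtx gtt : ℝ × ℝ → ℝ}
    (h : IsContinuousSolution a b ρ T γ β v vx vt gxx gtx gtt) (hγ : IsExpanding γ) (ha : 0 < a)
    (hb : 0 < b) (hρ : 0 < ρ) (hβ : LipschitzWith K β) (hβ0 : ∀ t, 0 ≤ β t)
    (hgrowth : ∀ᵐ t : ℝ, t ∈ Ioo 0 T → deriv β t ≤ lam * (ρ + 1) * β t)
    (hd : IsDecayRate a b ε lam)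
    (hγd : ∀ s ∈ Ico 0 T, ∃ γ', 0 ≤ γ' ∧ γ' ≤ 1 ∧ HasDerivWithinAt γ γ' (Ici s) s)
    {t : ℝ} (ht : t ∈ Icc 0 T) :
    energy ρ γ β v vx vt t ≤
      (a + b + 2) / min (1 / 2) b * energy ρ γ β v vx vt 0 * Real.exp (-(lam * t)) := by
  have hc0 : 0 < min (1 / 2) b := lt_min (by norm_num) hb
  have hE : ∀ t, energy ρ γ β v vx vt t = ∫ x in (0 : ℝ)..γ t, (1 / 2 * vt (x, t) ^ 2
      + 1 / 2 * vx (x, t) ^ 2 + 1 / 2 * v (x, t) ^ 2 + β t * potential ρ (v (x, t))) := by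
    intro t
    simp only [energy, potential, mul_assoc]
  have hV : ∀ z : ℝ × ℝ, 0 ≤ β z.2 * potential ρ (v z) := fun z =>
    mul_nonneg (hβ0 _) (potential_nonneg hρ _)
  have hce : ∀ t, Continuous fun x => 1 / 2 * vt (x, t) ^ 2
      + 1 / 2 * vx (x, t) ^ 2 + 1 / 2 * v (x, t) ^ 2 + β t * potential ρ (v (x, t)) := by
    intro t
    have c1 := h.continuous
    have c2 := h.continuous_fst
    have c3 := h.continuous_snd
    have c4 := continuous_potential hρ
    fun_prop
  have hcD : ∀ t, Continuous fun x => modifiedDensity a b ε ρ β v vx vt (x, t) := fun t =>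
    (h.continuous_density hρ hβ.continuous).comp (by fun_prop)
  have hlow : min (1 / 2) b * energy ρ γ β v vx vt t ≤
      ∫ x in (0 : ℝ)..γ t, modifiedDensity a b ε ρ β v vx vt (x, t) := by
    rw [hE, ← intervalIntegral.integral_const_mul]
    refine intervalIntegral.integral_mono_on (hγ.pos t).le
      (((hce t).const_mul _).intervalIntegrable _ _) ((hcD t).intervalIntegrable _ _) fun x _ => ?_
    exact hd.lower (hV (x, t))
  have hup : ∫ x in (0 : ℝ)..γ 0, modifiedDensity a b ε ρ β v vx vt (x, 0) ≤
      (a + b + 2) * energy ρ γ β v vx vt 0 := by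
    rw [hE, ← intervalIntegral.integral_const_mul]
    refine intervalIntegral.integral_mono_on (hγ.pos 0).le ((hcD 0).intervalIntegrable _ _)
      (((hce 0).const_mul _).intervalIntegrable _ _) fun x _ => ?_
    exact hd.upper ha hb (hV (x, 0))
  have hmain := h.modified_energy_le hγ ha hb hρ hβ hβ0 hgrowth hd hγd ht
  have hfin := hlow.trans (hmain.trans (mul_le_mul_of_nonneg_right hup (Real.exp_pos _).le))
  have h1 : (a + b + 2) / min (1 / 2) b * energy ρ γ β v vx vt 0 * Real.exp (-(lam * t))
      = (a + b + 2) * energy ρ γ β v vx vt 0 * Real.exp (-(lam * t)) / min (1 / 2) b := by ring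
  rw [h1, le_div_iff₀ hc0, mul_comm]
  exact hfin

lemma energy_congr {ρ T : ℝ} {α γ β β' : ℝ → ℝ} (hα : EqOn α γ (Icc 0 T))
    (hβ : EqOn β β' (Icc 0 T)) (v vx vt : ℝ × ℝ → ℝ) {t : ℝ} (ht : t ∈ Icc 0 T) :
    energy ρ α β v vx vt t = energy ρ γ β' v vx vt t := by
  simp only [energy, hα ht, hβ ht]

/-- One `ε = min 1 (a/2)` serves every rate. The bound `λ₀ = εb/(a + b + 1)` is `rate_mul_le` solved
for `λ`, and implies `λ ≤ ε` since `b ≤ a + b + 1`. -/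
lemma exists_isDecayRate {a b : ℝ} (ha : 0 < a) (hb : 0 < b) :
    ∃ lam₀ : ℝ, 0 < lam₀ ∧ ∃ ε, ∀ lam, 0 < lam → lam ≤ lam₀ → IsDecayRate a b ε lam := by
  have hε : 0 < min 1 (a / 2) := lt_min one_pos (by linarith)
  have hab : 0 < a + b + 1 := by linarith
  refine ⟨min 1 (a / 2) * b / (a + b + 1), by positivity, min 1 (a / 2), fun lam h0 hle => ?_⟩
  have h1 := (le_div_iff₀ hab).1 hle
  refine ⟨hε, min_le_left _ _, min_le_right _ _, h0, ?_, h1⟩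
  refine hle.trans ((div_le_iff₀ hab).2 (mul_le_mul_of_nonneg_left (by linarith) hε.le))

theorem theorem1p2 (a b : ℝ) (ha : 0 < a) (hb : 0 < b) :
    ∃ lam₀ : ℝ, 0 < lam₀ ∧ ∃ C : ℝ, 0 < C ∧
      ∀ lam : ℝ, 0 < lam → lam ≤ lam₀ → ∀ ρ : ℝ, 0 < ρ →
        -- exponential decay of the energy, with constants depending on `a` and `b` only
        (∀ T : ℝ, 0 < T → ∀ α : ℝ → ℝ, IsMovingBoundary T α →
          ∀ β : ℝ → ℝ, IsAdmissibleCoefficient lam ρ T β →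
          ∀ (u₀ u₁ : ℝ → ℝ) (u ux ut uxx utx utt : ℝ × ℝ → ℝ),
            IsStrongSolution a b ρ T α β u₀ u₁ u ux ut uxx utx utt →
            ∃ v vx vt : ℝ × ℝ → ℝ,
              IsContinuousRepresentative T α u v ∧
              IsContinuousRepresentative T α ux vx ∧
              IsContinuousRepresentative T α ut vt ∧
              (∀ᵐ x ∂(volume.restrict (Ioo (0 : ℝ) 1)), v (x, 0) = u₀ x ∧ vt (x, 0) = u₁ x) ∧
              ∀ t ∈ Icc 0 T,
                energy ρ α β v vx vt t ≤ C * energy ρ α β v vx vt 0 * Real.exp (-(lam * t))) ∧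
        -- growing exponentials are admissible
        (∀ μ : ℝ, μ ≤ lam * (ρ + 1) → ∀ T : ℝ, 0 < T →
          IsAdmissibleCoefficient lam ρ T (fun t => Real.exp (μ * t))) ∧
        -- so are suitable polynomials of any degree with positive coefficients
        (∀ n : ℕ, ∃ p : Polynomial ℝ, p.natDegree = n ∧ (∀ i ≤ n, 0 < p.coeff i) ∧
          ∀ T : ℝ, 0 < T → IsAdmissibleCoefficient lam ρ T (fun t => p.eval t)) := by

  obtain ⟨lam₀, hlam₀, ε, hε⟩ := exists_isDecayRate ha hb
  refine ⟨lam₀, hlam₀, (a + b + 2) / min (1 / 2) b,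
    div_pos (by linarith) (lt_min (by norm_num) hb), fun lam h0 hle ρ hρ => ⟨?_, ?_, ?_⟩⟩
  · intro T hT α hα β hβ u₀ u₁ u ux ut uxx utx utt hu
    have hγ := hα.isExpanding hT.le
    have eα := eqOn_IccExtend_restrict hT.le α
    have eβ := eqOn_IccExtend_restrict hT.le β
    obtain ⟨K, hK⟩ := hβ.lipschitz
    have hgrowth : ∀ᵐ t : ℝ, t ∈ Ioo 0 T →
        deriv (IccExtend hT.le ((Icc 0 T).domRestrict β)) t
          ≤ lam * (ρ + 1) * IccExtend hT.le ((Icc 0 T).domRestrict β) t := by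
      filter_upwards [(ae_restrict_iff' measurableSet_Ioo).1 hβ.growth] with t ht htI
      have h1 : IccExtend hT.le ((Icc 0 T).domRestrict β) =ᶠ[𝓝 t] β := by
        filter_upwards [Icc_mem_nhds htI.1 htI.2] with s hs using (eβ hs).symm
      rw [h1.deriv_eq, ← eβ (Ioo_subset_Icc_self htI)]
      exact ht htI
    obtain ⟨v, vx, vt, gxx, gtx, gtt, hv, hvu, hvx, hvt, hini⟩ :=
      (hu.congr eα eβ).exists_isContinuousSolution hT hγ
    rw [← movingDomain_congr eα] at hvu hvx hvt
    refine ⟨v, vx, vt, ⟨hv.continuous.continuousOn, hvu⟩, ⟨hv.continuous_fst.continuousOn, hvx⟩,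
      ⟨hv.continuous_snd.continuousOn, hvt⟩, hini, fun t ht => ?_⟩
    rw [energy_congr eα eβ v vx vt ht, energy_congr eα eβ v vx vt (left_mem_Icc.2 hT.le)]
    exact hv.energy_le hγ ha hb hρ (hK.IccExtend_restrict hT.le)
      (fun t => hβ.nonneg _ (projIcc 0 T hT.le t).2) hgrowth (hε lam h0 hle)
      (fun s hs => hα.hasDerivWithinAt hT.le hs) ht
  · exact fun μ hμ T _ => isAdmissibleCoefficient_exp hμ
  · exact exists_polynomial_isAdmissibleCoefficient h0 hρ
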